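/- Let $\mathcal N(0,1)_{\mathbb C}$ be the standard complex Gaussian, with density $\frac1\pi e^{-|z|^2}$ on $\mathbb C$. For $n\ge 1$ let $X=(x_{ij})\in\mathbb C^{n\times n}$ have independent $\mathcal N(0,1)_{\mathbb C}$ entries (write $\mathcal N$ for the law of $X$), and put $$R_i=\sum_{j=1}^n|x_{ij}|^2,\qquad R=R_1\cdots R_n,\qquad R^*=\frac{R}{n^n},\qquad L=\ln R .$$ Let $\ell_n=\ln\left(|x_1|^2+\cdots+|x_n|^2\right)$ with $x_1,\dots,x_n$ independent and $\mathcal N(0,1)_{\mathbb C}$-distributed, i.e. $\ell_n$ is the logarithm of a complex $\chi^2$ variable with $n$ degrees of freedom. Then, for every $n\ge1$, almost surely $L=\ln R_1+\cdots+\ln R_n$, where the $\ln R_i$ are independent and each is distributed as $\ell_n$; $\ell_n$ has a finite second moment, and $R^*$ is integrable. Moreover: 1. Let $L'$ be a real Gaussian with mean $n\operatorname{E}[\ell_n]$ and variance $n\operatorname{Var}[\ell_n]$. There is an absolute constant $C$ such that for all $n\ge 1$ and all $x\in\mathbb R$, $$\bigl|\Pr[L\le x]-\Pr[L'\le x]\bigr|\le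 \frac{C}{\sqrt n}.$$ 2. There is an absolute constant $C$ such that for all $n\ge1$, $$\Pr_{\mathcal N}\left[|R^*-1|\ge\tfrac12\right]\ge 0.586-\frac{C}{\sqrt n}.$$ 3. There is an absolute constant $C$ such that for all $n\ge1$, $$\tfrac12\operatorname{E}_{\mathcal N}\bigl[|R^*-1|\bigr]\ge 0.146-\frac{C}{\sqrt n}.$$ -/

import Mathlib

open MeasureTheory ProbabilityTheory

namespace RowNorm

/-- The standard complex Gaussian `N(0,1)_ℂ`: the measure on `ℂ` with density `exp(-|z|²) / π`
with respect to Lebesgue measure, so that the mean is `0` and `E|z|² = 1`. -/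
noncomputable def complexGaussian : Measure ℂ :=
  (volume : Measure ℂ).withDensity
    (fun z => ENNReal.ofReal (Real.exp (-‖z‖ ^ 2) / Real.pi))

instance isProbabilityMeasure_complexGaussian : IsProbabilityMeasure complexGaussian := by
  have h := GaussianFourier.integral_rexp_neg_mul_sq_norm (V := ℂ) (b := 1) one_pos
  simp only [neg_mul, one_mul, Complex.finrank_real_complex, Nat.cast_ofNat, div_one,
    div_self (two_ne_zero : (2 : ℝ) ≠ 0), Real.rpow_one] at h
  have hint : Integrable (fun z : ℂ => Real.exp (-‖z‖ ^ 2)) := by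
    by_contra hc
    rw [integral_undef hc] at h
    exact Real.pi_ne_zero h.symm
  constructor
  rw [complexGaussian, withDensity_apply _ MeasurableSet.univ, Measure.restrict_univ,
    ← ofReal_integral_eq_lintegral_ofReal (hint.div_const _)
      (Filter.Eventually.of_forall fun z => by positivity),
    integral_div, h, div_self Real.pi_ne_zero, ENNReal.ofReal_one]

/-- The law of a vector of `n` independent standard complex Gaussians. -/
noncomputable def gaussianVector (n : ℕ) : Measure (Fin n → ℂ) :=
  Measure.pi fun _ => complexGaussian

instance isProbabilityMeasure_gaussianVector (n : ℕ) :
    IsProbabilityMeasure (gaussianVector n) := by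
  unfold gaussianVector; infer_instance

/-- The law `N(0,1)_ℂ^{n × n}` of an `n × n` matrix (as a function of row and column index) of
independent standard complex Gaussians. -/
noncomputable def gaussianMatrix (n : ℕ) : Measure (Fin n → Fin n → ℂ) :=
  Measure.pi fun _ => gaussianVector n

instance isProbabilityMeasure_gaussianMatrix (n : ℕ) :
    IsProbabilityMeasure (gaussianMatrix n) := by
  unfold gaussianMatrix; infer_instance

/-- `|x₁|² + ⋯ + |xₙ|²`. Under `gaussianVector n` this is a complex chi-square variable with
`n` degrees of freedom. -/
noncomputable def sqNorm {n : ℕ} (x : Fin n → ℂ) : ℝ := ∑ j, ‖x j‖ ^ 2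

/-- `ℓₙ = ln(|x₁|² + ⋯ + |xₙ|²)`, a random variable on the space of `gaussianVector n`. -/
noncomputable def ell (n : ℕ) (x : Fin n → ℂ) : ℝ := Real.log (sqNorm x)

/-- `Rᵢ(X)`, the squared 2-norm of the `i`-th row. -/
noncomputable def rowSq {n : ℕ} (i : Fin n) (X : Fin n → Fin n → ℂ) : ℝ := sqNorm (X i)

/-- `R(X) = R₁(X) ⋯ Rₙ(X)`. -/
noncomputable def R {n : ℕ} (X : Fin n → Fin n → ℂ) : ℝ := ∏ i, rowSq i X

/-- `L = ln R`. -/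
noncomputable def L {n : ℕ} (X : Fin n → Fin n → ℂ) : ℝ := Real.log (R X)

/-- `R* = R / nⁿ`. -/
noncomputable def Rstar {n : ℕ} (X : Fin n → Fin n → ℂ) : ℝ := R X / (n : ℝ) ^ n

end RowNorm

/-!
The squared norm of a row is a gamma variable `G` of shape `n` and rate `1` (`map_sqNorm`), so `L`
is a sum of `n` independent copies of `log G`. The normal approximation of `L` does not need the
Berry-Esseen theorem. The density of `log G` is proportional to `exp (n y - e ^ y)`, and
integration by parts gives the score identity `E[(G - n) h(log G)] = E[h'(log G)]`
(`integral_score_gammaMeasure`), which by Fubini carries over to sums: the score of `L` is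
`U = ∑ (G_i - n) / n`, that is, `E[U h(L)] = E[h'(L)]` (`integral_score_pi_gammaMeasure`).

Let `v = Var[ℓₙ]`, `s² = n v`, and let `W` be the normalisation of `L`. If `f` is the bounded
solution of Stein's equation `f' w - w f w = 1_{w ≤ x} - Φ(x)` (`exists_stein_solution`), then
`P(W ≤ x) - Φ(x) = E[f'(W) - W f(W)] = E[(s U - W) f(W)]`, which is at most
`‖f‖ √Var(s U - W)`. The variables `U` and `W` have variance `1`, and their covariance is `1 / s`
by the score identity for the identity function, so that `Var(s U - W) = n v - 1`
(`abs_cdf_sum_log_gamma_sub_le`). The inequality `(log u)² ≤ u - 2 + 1 / u` at `u = G / n` gives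
`v ≤ 1 / (n - 1)` (`variance_log_gammaMeasure_le`), hence a distance of order `1 / √n`.

For the fluctuations of `R*`, the mean `n (E[ℓₙ] - log n)` of `log R*` lies between
`-n / (2n - 1)` and `-1/2`, by the recurrence of the digamma function
(`integral_log_gammaMeasure_le`, `le_integral_log_gammaMeasure`), and its variance `n v` lies
between `1` and `1 + 1 / (n - 1)`. So `log R*` is close to a normal variable with mean `-1/2` and
variance `1`, which lies in `(-log 2, log (3/2))` with probability less than `0.41`
(`gaussianReal_Ioc_le`). The bound for the expectation follows by Markov's inequality.
-/

namespace RowNorm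

/-! ### Gamma laws and the squared norm of a complex Gaussian vector -/

theorem integrableOn_pow_mul_cexp_neg_mul (k : ℕ) {b : ℂ} (hb : 0 < b.re) :
    IntegrableOn (fun x : ℝ => (x : ℂ) ^ k * Complex.exp (-b * x)) (Set.Ioi 0) := by
  have h := integrableOn_rpow_mul_exp_neg_mul_rpow (s := k) (p := 1) (b := b.re)
    (by have : (0 : ℝ) ≤ k := k.cast_nonneg
        linarith) one_pos hb
  refine h.mono' (by fun_prop) ?_
  filter_upwards [self_mem_ae_restrict measurableSet_Ioi] with x hx
  rw [norm_mul, norm_pow, Complex.norm_real, Complex.norm_exp, Real.norm_of_nonneg (le_of_lt hx)]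
  simp

/-- The Gamma integral with complex rate `b`, by integration by parts in `k`. -/
theorem integral_pow_mul_cexp_neg_mul (k : ℕ) {b : ℂ} (hb : 0 < b.re) :
    ∫ x : ℝ in Set.Ioi 0, (x : ℂ) ^ k * Complex.exp (-b * x) = (k.factorial : ℂ) / b ^ (k + 1) := by
  have hb0 : b ≠ 0 := by rintro rfl; simp at hb
  induction k with
  | zero =>
    have h := integral_exp_mul_complex_Ioi (a := -b) (by simpa using hb) 0
    simpa [neg_div_neg_eq] using h
  | succ k ih =>
    have hd : ∀ x ∈ Set.Ici (0 : ℝ), HasDerivAt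
        (fun x : ℝ => (x : ℂ) ^ (k + 1) * Complex.exp (-b * x))
        ((k + 1) * ((x : ℂ) ^ k * Complex.exp (-b * x))
          - b * ((x : ℂ) ^ (k + 1) * Complex.exp (-b * x))) x := by
      intro x _
      have h1 : HasDerivAt (fun x : ℂ => x ^ (k + 1) * Complex.exp (-b * x))
          ((k + 1) * ((x : ℂ) ^ k * Complex.exp (-b * x))
          - b * ((x : ℂ) ^ (k + 1) * Complex.exp (-b * x))) x := by
        convert! (hasDerivAt_pow (k + 1) (x : ℂ)).mul
          (((hasDerivAt_id (x : ℂ)).const_mul (-b)).cexp) using 1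
        simp
        ring
      exact h1.comp_ofReal
    have hi1 := integrableOn_pow_mul_cexp_neg_mul k hb
    have hi2 := integrableOn_pow_mul_cexp_neg_mul (k + 1) hb
    have ht : Filter.Tendsto (fun x : ℝ => (x : ℂ) ^ (k + 1) * Complex.exp (-b * x))
        Filter.atTop (nhds 0) := by
      rw [tendsto_zero_iff_norm_tendsto_zero]
      refine (tendsto_rpow_mul_exp_neg_mul_atTop_nhds_zero (k + 1 : ℕ) b.re hb).congr' ?_
      filter_upwards [Filter.eventually_ge_atTop 0] with x hx
      rw [norm_mul, norm_pow, Complex.norm_real, Complex.norm_exp, Real.norm_of_nonneg hx,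
        Real.rpow_natCast]
      simp
    have h := integral_Ioi_of_hasDerivAt_of_tendsto' hd
      ((hi1.const_mul _).sub (hi2.const_mul _)) ht
    rw [integral_sub (hi1.const_mul _) (hi2.const_mul _), integral_const_mul, integral_const_mul,
      ih] at h
    simp only [Complex.ofReal_zero, ne_eq, Nat.add_eq_zero_iff, one_ne_zero, and_false,
      not_false_eq_true, zero_pow, zero_mul, sub_zero, sub_eq_zero] at h
    rw [Nat.factorial_succ, pow_succ b (k + 1), eq_div_iff (by positivity)]
    rw [mul_comm, mul_assoc, ← h, Nat.cast_mul]
    field_simp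
    simp [mul_comm]

theorem integral_gammaMeasure {a : ℝ} (ha : 0 < a) {E : Type*} [NormedAddCommGroup E]
    [NormedSpace ℝ E] (F : ℝ → E) :
    ∫ x, F x ∂(gammaMeasure a 1)
      = ∫ x in Set.Ioi 0, ((Real.Gamma a)⁻¹ * (x ^ (a - 1) * Real.exp (-x))) • F x := by
  have hm : Measurable (gammaPDF a 1) := (measurable_gammaPDFReal a 1).ennreal_ofReal
  rw [gammaMeasure, integral_withDensity_eq_integral_toReal_smul hm
    (by simp [gammaPDF]), ← setIntegral_eq_integral_of_forall_compl_eq_zero (s := Set.Ici 0),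
    integral_Ici_eq_integral_Ioi]
  · refine setIntegral_congr_fun measurableSet_Ioi fun x hx => ?_
    have hx : 0 < x := hx
    simp only [gammaPDF_of_nonneg hx.le]
    rw [ENNReal.toReal_ofReal (by have := Real.Gamma_pos_of_pos ha; positivity)]
    simp [mul_assoc]
  · intro x hx
    simp [gammaPDF_of_neg (not_le.mp hx)]

theorem integrable_gammaMeasure_iff {a : ℝ} (ha : 0 < a) {F : ℝ → ℝ} :
    Integrable F (gammaMeasure a 1)
      ↔ IntegrableOn (fun x => x ^ (a - 1) * Real.exp (-x) * F x) (Set.Ioi 0) := by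
  have hG := Real.Gamma_pos_of_pos ha
  have hm : Measurable (gammaPDF a 1) := (measurable_gammaPDFReal a 1).ennreal_ofReal
  rw [gammaMeasure, integrable_withDensity_iff_integrable_smul' hm (by simp [gammaPDF]),
    ← integrableOn_iff_integrable_of_support_subset (s := Set.Ici 0),
    integrableOn_Ici_iff_integrableOn_Ioi]
  · have : IntegrableOn (fun x => (gammaPDF a 1 x).toReal • F x) (Set.Ioi 0) ↔
        IntegrableOn (fun x => (Real.Gamma a)⁻¹ * (x ^ (a - 1) * Real.exp (-x) * F x))
          (Set.Ioi 0) := by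
      refine integrableOn_congr_fun (fun x hx => ?_) measurableSet_Ioi
      have hx : 0 < x := hx
      simp only [gammaPDF_of_nonneg hx.le]
      rw [ENNReal.toReal_ofReal (by positivity)]
      simp [mul_assoc]
    rw [this]
    refine ⟨fun h => ?_, fun h => h.const_mul _⟩
    refine (h.const_mul (Real.Gamma a)).congr (Filter.Eventually.of_forall fun x => ?_)
    field_simp
  · intro x hx
    by_contra hx'
    exact hx (by simp [gammaPDF_of_neg (not_le.mp hx')])

theorem charFun_gammaMeasure_natCast {n : ℕ} (hn : 1 ≤ n) (t : ℝ) :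
    charFun (gammaMeasure n 1) t = (1 / (1 - t * Complex.I)) ^ n := by
  have hn0 : (0 : ℝ) < n := by exact_mod_cast hn
  have hre : 0 < (1 - t * Complex.I : ℂ).re := by simp
  obtain ⟨k, rfl⟩ : ∃ k, n = k + 1 := ⟨n - 1, by omega⟩
  have h := integral_pow_mul_cexp_neg_mul k hre
  rw [charFun_apply_real, integral_gammaMeasure hn0]
  have : ∀ x ∈ Set.Ioi (0 : ℝ), ((Real.Gamma (k + 1 : ℕ))⁻¹ *
      (x ^ (((k + 1 : ℕ) : ℝ) - 1) * Real.exp (-x))) • Complex.exp (t * x * Complex.I)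
      = (k.factorial : ℂ)⁻¹ * ((x : ℂ) ^ k * Complex.exp (-(1 - t * Complex.I) * x)) := by
    intro x _
    have e : ((k + 1 : ℕ) : ℝ) - 1 = k := by push_cast; ring
    rw [e, Real.rpow_natCast, Nat.cast_succ, Real.Gamma_nat_eq_factorial, Complex.real_smul]
    have : Complex.exp (-(1 - t * Complex.I) * x)
        = Complex.exp (-x) * Complex.exp (t * x * Complex.I) := by
      rw [← Complex.exp_add]; ring_nf
    rw [this]
    push_cast
    ring
  rw [setIntegral_congr_fun measurableSet_Ioi this, integral_const_mul, h]
  have hf : (k.factorial : ℂ) ≠ 0 := by exact_mod_cast k.factorial_ne_zero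
  rw [one_div_pow]
  field_simp

theorem integral_complexGaussian {E : Type*} [NormedAddCommGroup E] [NormedSpace ℝ E]
    (F : ℂ → E) : ∫ z, F z ∂complexGaussian = ∫ z, (Real.exp (-‖z‖ ^ 2) / Real.pi) • F z := by
  rw [complexGaussian, integral_withDensity_eq_integral_toReal_smul (by fun_prop) (by simp)]
  congr with z
  rw [ENNReal.toReal_ofReal (by positivity)]

theorem charFun_map_norm_sq_complexGaussian (t : ℝ) :
    charFun (complexGaussian.map fun z => ‖z‖ ^ 2) t = 1 / (1 - t * Complex.I) := by
  have hre : 0 < (1 - t * Complex.I : ℂ).re := by simp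
  have h := GaussianFourier.integral_cexp_neg_mul_sq_norm (V := ℂ) hre
  rw [charFun_apply_real, integral_map (by fun_prop) (by fun_prop), integral_complexGaussian]
  have : ∀ z : ℂ, (Real.exp (-‖z‖ ^ 2) / Real.pi) • Complex.exp (t * (‖z‖ ^ 2 : ℝ) * Complex.I)
      = (Real.pi : ℂ)⁻¹ * Complex.exp (-(1 - t * Complex.I) * (‖z‖ : ℂ) ^ 2) := by
    intro z
    rw [Complex.real_smul, Complex.ofReal_div, Complex.ofReal_exp, div_eq_inv_mul, mul_assoc,
      ← Complex.exp_add]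
    push_cast
    ring_nf
  simp_rw [this]
  rw [integral_const_mul, h]
  have hpi : (Real.pi : ℂ) ≠ 0 := by exact_mod_cast Real.pi_ne_zero
  simp [Complex.finrank_real_complex]
  field_simp

theorem measurable_sqNorm {n : ℕ} : Measurable (sqNorm (n := n)) := by
  unfold sqNorm; fun_prop

/-- A complex chi-square variable with `n` degrees of freedom is a gamma variable of shape `n` and
rate `1`: both have characteristic function `(1 - it)⁻ⁿ`. -/
theorem map_sqNorm {n : ℕ} (hn : 1 ≤ n) :
    (gaussianVector n).map sqNorm = gammaMeasure n 1 := by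
  have hn0 : (0 : ℝ) < n := by exact_mod_cast hn
  have := isProbabilityMeasure_gammaMeasure hn0 one_pos
  have := Measure.isProbabilityMeasure_map (μ := gaussianVector n) measurable_sqNorm.aemeasurable
  apply Measure.ext_of_charFun
  ext t
  have hind : iIndepFun (fun (i : Fin n) (x : Fin n → ℂ) => ‖x i‖ ^ 2) (gaussianVector n) :=
    iIndepFun_pi (X := fun _ z => ‖z‖ ^ 2) fun i => (by fun_prop : Measurable _).aemeasurable
  have hs : (sqNorm : (Fin n → ℂ) → ℝ) = ∑ i, fun x : Fin n → ℂ => ‖x i‖ ^ 2 := by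
    ext x; simp [sqNorm]
  rw [hs, hind.charFun_map_sum_eq_prod (fun i => (by fun_prop : Measurable _).aemeasurable),
    Finset.prod_apply,
    charFun_gammaMeasure_natCast hn]
  have : ∀ i : Fin n, (gaussianVector n).map (fun x => ‖x i‖ ^ 2)
      = complexGaussian.map fun z => ‖z‖ ^ 2 := by
    intro i
    rw [← (measurePreserving_eval (fun _ : Fin n => complexGaussian) i).map_eq,
      Measure.map_map (by fun_prop) (by fun_prop)]
    rfl
  simp [this, charFun_map_norm_sq_complexGaussian]

/-! ### Moments of a gamma variable and of its logarithm -/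

/-- This is `|y| ≤ |sinh y|` at `y = log t`. -/
theorem abs_log_le_abs_sub_inv {t : ℝ} (ht : 0 < t) : 2 * |Real.log t| ≤ |t - t⁻¹| := by
  have h := Real.self_le_sinh_iff.mpr (abs_nonneg (Real.log t))
  rw [← Real.abs_sinh, Real.sinh_log ht, abs_div, abs_two] at h
  linarith

/-- An upper bound of `(log u)²` which is sharp to second order at `u = 1` and whose mean under a
gamma law is explicit. -/
theorem sq_log_le {u : ℝ} (hu : 0 < u) : Real.log u ^ 2 ≤ u - 2 + u⁻¹ := by
  have hs := Real.sqrt_pos.mpr hu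
  have h := abs_log_le_abs_sub_inv hs
  rw [Real.log_sqrt hu.le] at h
  have h2 : |Real.log u| ≤ |√u - (√u)⁻¹| := by
    have : 2 * |Real.log u / 2| = |Real.log u| := by rw [abs_div, abs_two]; ring
    linarith
  refine (sq_le_sq.mpr h2).trans_eq ?_
  have h3 := Real.sq_sqrt hu.le
  have : (√u - (√u)⁻¹) ^ 2 = √u ^ 2 - 2 + (√u ^ 2)⁻¹ := by
    field_simp
    ring
  rw [this, h3]

theorem ae_pos_gammaMeasure (a : ℝ) : ∀ᵐ x ∂(gammaMeasure a 1), 0 < x := by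
  have hm : Measurable (gammaPDF a 1) := (measurable_gammaPDFReal a 1).ennreal_ofReal
  rw [gammaMeasure, ae_withDensity_iff hm]
  have : ∀ᵐ x : ℝ, x ≠ 0 := Measure.ae_ne volume 0
  filter_upwards [this] with x hx h
  by_contra hx'
  exact h (gammaPDF_of_neg (lt_of_le_of_ne (not_lt.mp hx') hx))

theorem integrable_rpow_gammaMeasure {a p : ℝ} (ha : 0 < a) (hp : 0 < a + p) :
    Integrable (fun x => x ^ p) (gammaMeasure a 1) := by
  rw [integrable_gammaMeasure_iff ha]
  refine (Real.GammaIntegral_convergent hp).congr_fun (fun x hx => ?_) measurableSet_Ioi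
  have hx : 0 < x := hx
  dsimp only
  rw [show a + p - 1 = (a - 1) + p by ring, Real.rpow_add hx]
  ring

theorem integral_rpow_gammaMeasure {a p : ℝ} (ha : 0 < a) (hp : 0 < a + p) :
    ∫ x, x ^ p ∂(gammaMeasure a 1) = Real.Gamma (a + p) / Real.Gamma a := by
  rw [integral_gammaMeasure ha, Real.Gamma_eq_integral hp, div_eq_inv_mul, ← integral_const_mul]
  refine setIntegral_congr_fun measurableSet_Ioi fun x hx => ?_
  have hx : 0 < x := hx
  rw [show a + p - 1 = (a - 1) + p by ring, Real.rpow_add hx, smul_eq_mul]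
  ring

theorem memLp_id_gammaMeasure {a : ℝ} (ha : 0 < a) : MemLp (fun x => x) 2 (gammaMeasure a 1) := by
  rw [memLp_two_iff_integrable_sq measurable_id'.aestronglyMeasurable]
  exact (integrable_rpow_gammaMeasure (p := 2) ha (by linarith)).congr
    (Filter.Eventually.of_forall fun x => Real.rpow_two x)

/-- For `a = 1` the function `x⁻¹` is not integrable near `0`, so that `sq_log_le` is applied to
`√x`. -/
theorem memLp_log_gammaMeasure {a : ℝ} (ha : 1 ≤ a) :
    MemLp Real.log 2 (gammaMeasure a 1) := by
  have ha0 : 0 < a := by linarith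
  rw [memLp_two_iff_integrable_sq Real.measurable_log.aestronglyMeasurable]
  have h1 := integrable_rpow_gammaMeasure (p := 1 / 2) ha0 (by linarith)
  have h2 := integrable_rpow_gammaMeasure (p := -(1 / 2)) ha0 (by linarith)
  refine ((h1.add h2).const_mul 4).mono' (by fun_prop) ?_
  filter_upwards [ae_pos_gammaMeasure a] with x hx
  have h := sq_log_le (Real.rpow_pos_of_pos hx (1 / 2))
  rw [Real.log_rpow hx] at h
  simp only [Pi.add_apply]
  rw [Real.rpow_neg hx.le, Real.norm_of_nonneg (sq_nonneg _)]
  nlinarith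

theorem integral_id_gammaMeasure {a : ℝ} (ha : 0 < a) : ∫ x, x ∂(gammaMeasure a 1) = a := by
  have h := integral_rpow_gammaMeasure (p := 1) ha (by linarith)
  rw [Real.Gamma_add_one ha.ne'] at h
  simpa [(Real.Gamma_pos_of_pos ha).ne'] using h

theorem variance_id_gammaMeasure {a : ℝ} (ha : 0 < a) :
    variance (fun x => x) (gammaMeasure a 1) = a := by
  have := isProbabilityMeasure_gammaMeasure ha one_pos
  have h := integral_rpow_gammaMeasure (p := 2) ha (by linarith)
  rw [show a + 2 = (a + 1) + 1 by ring, Real.Gamma_add_one (by linarith),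
    Real.Gamma_add_one ha.ne'] at h
  have hG := (Real.Gamma_pos_of_pos ha).ne'
  rw [variance_eq_sub (memLp_id_gammaMeasure ha)]
  have : ∫ x, ((fun x : ℝ => x) ^ 2) x ∂(gammaMeasure a 1) = (a + 1) * a := by
    simp only [Real.rpow_two] at h
    simp only [Pi.pow_apply]
    rw [h]; field_simp
  rw [this, integral_id_gammaMeasure ha]
  ring

theorem integral_inv_gammaMeasure {a : ℝ} (ha : 1 < a) :
    Integrable (fun x => x⁻¹) (gammaMeasure a 1) ∧
      ∫ x, x⁻¹ ∂(gammaMeasure a 1) = (a - 1)⁻¹ := by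
  have h := integral_rpow_gammaMeasure (a := a) (p := -1) (by linarith) (by linarith)
  have hi := integrable_rpow_gammaMeasure (a := a) (p := -1) (by linarith) (by linarith)
  have hG := Real.Gamma_add_one (s := a - 1) (by linarith)
  have hG0 := (Real.Gamma_pos_of_pos (s := a - 1) (by linarith)).ne'
  have h1 : a - 1 ≠ 0 := by linarith
  rw [sub_add_cancel] at hG
  simp only [Real.rpow_neg_one] at h hi
  refine ⟨hi, h.trans ?_⟩
  rw [hG, ← sub_eq_add_neg]
  field_simp

theorem integral_sq_log_div_le {a : ℝ} (ha : 1 < a) :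
    ∫ x, Real.log (x / a) ^ 2 ∂(gammaMeasure a 1) ≤ (a - 1)⁻¹ := by
  have ha0 : 0 < a := by linarith
  have := isProbabilityMeasure_gammaMeasure ha0 one_pos
  obtain ⟨hi, he⟩ := integral_inv_gammaMeasure ha
  have hx : Integrable (fun x => x) (gammaMeasure a 1) :=
    (memLp_id_gammaMeasure ha0).integrable one_le_two
  have hb : ∫ x, (x / a - 2 + a * x⁻¹) ∂(gammaMeasure a 1) = (a - 1)⁻¹ := by
    have e := integral_add ((hx.div_const a).sub (integrable_const 2)) (hi.const_mul a)
    simp only [Pi.sub_apply] at e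
    rw [e,
      integral_sub (hx.div_const a) (integrable_const 2), integral_const_mul, he, integral_div,
      integral_id_gammaMeasure ha0, div_self ha0.ne']
    have : a - 1 ≠ 0 := by linarith
    simp
    field_simp
    ring
  rw [← hb]
  refine integral_mono_of_nonneg (Filter.Eventually.of_forall fun x => sq_nonneg _)
    (((hx.div_const a).sub (integrable_const 2)).add (hi.const_mul a)) ?_
  filter_upwards [ae_pos_gammaMeasure a] with x hx
  have h := sq_log_le (u := x / a) (by positivity)
  rwa [inv_div, div_eq_mul_inv a x] at h

/-- The variance is at most the second moment about `log a`; together with the lower bound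
`one_le_mul_variance_log_gammaMeasure` this locates `a * Var[log]` between `1` and
`1 + 1 / (a - 1)`. -/
theorem variance_log_gammaMeasure_le {a : ℝ} (ha : 1 < a) :
    variance Real.log (gammaMeasure a 1) ≤ (a - 1)⁻¹ := by
  have ha0 : 0 < a := by linarith
  have := isProbabilityMeasure_gammaMeasure ha0 one_pos
  refine le_trans ?_ (integral_sq_log_div_le ha)
  have e : variance Real.log (gammaMeasure a 1)
      = variance (fun x => Real.log x - Real.log a) (gammaMeasure a 1) := by
    rw [variance_sub_const Real.measurable_log.aestronglyMeasurable]
  rw [e]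
  refine (variance_le_expectation_sq (by fun_prop)).trans_eq ?_
  refine integral_congr_ae ?_
  filter_upwards [ae_pos_gammaMeasure a] with x hx
  simp [Real.log_div hx.ne' ha0.ne']

/-! ### The score identity -/

theorem memLp_comp_of_abs_le {Ω : Type*} [MeasurableSpace Ω] {P : Measure Ω} [IsFiniteMeasure P]
    {Y : Ω → ℝ} {K : ℝ} (hY : MemLp Y 2 P) {h : ℝ → ℝ} (hm : Measurable h)
    (hK : ∀ y, |h y| ≤ K * (1 + |y|)) : MemLp (fun ω => h (Y ω)) 2 P := by
  have h1 : MemLp (fun _ : Ω => (1 : ℝ)) 2 P := memLp_const 1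
  have h3 : MemLp (fun ω => K * (1 + |Y ω|)) 2 P := (h1.add hY.norm).const_mul K
  exact h3.mono' (hm.comp_aemeasurable hY.aemeasurable).aestronglyMeasurable
    (Filter.Eventually.of_forall fun ω => hK _)

theorem tendsto_gamma_boundary_zero {a K : ℝ} (ha : 1 ≤ a) {h : ℝ → ℝ}
    (hK : ∀ y, |h y| ≤ K * (1 + |y|)) :
    Filter.Tendsto (fun x => x ^ a * Real.exp (-x) * h (Real.log x))
      (nhdsWithin 0 (Set.Ioi 0)) (nhds 0) := by
  have hK0 : 0 ≤ K := by simpa using (abs_nonneg _).trans (hK 0)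
  have ha0 : 0 < a := by linarith
  have t1 : Filter.Tendsto (fun x : ℝ => x ^ a) (nhdsWithin 0 (Set.Ioi 0)) (nhds 0) := by
    have := (Real.continuousAt_rpow_const 0 a (Or.inr ha0.le)).tendsto
    rw [Real.zero_rpow ha0.ne'] at this
    exact this.mono_left nhdsWithin_le_nhds
  have t2 := (tendsto_log_mul_rpow_nhdsGT_zero ha0).abs
  have t3 := (t1.add t2).const_mul K
  rw [abs_zero, add_zero, mul_zero] at t3
  refine squeeze_zero_norm' ?_ t3
  filter_upwards [self_mem_nhdsWithin] with x hx
  have hx : 0 < x := hx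
  have hp := Real.rpow_pos_of_pos hx a
  have he : Real.exp (-x) ≤ 1 := Real.exp_le_one_iff.mpr (by linarith)
  rw [Real.norm_eq_abs, abs_mul, abs_mul, abs_mul, abs_of_pos hp, abs_of_pos (Real.exp_pos _)]
  calc x ^ a * Real.exp (-x) * |h (Real.log x)| ≤ x ^ a * 1 * (K * (1 + |Real.log x|)) := by
        gcongr
        exact hK _
    _ = _ := by ring

theorem tendsto_gamma_boundary_atTop {a K : ℝ} {h : ℝ → ℝ}
    (hK : ∀ y, |h y| ≤ K * (1 + |y|)) :
    Filter.Tendsto (fun x => x ^ a * Real.exp (-x) * h (Real.log x)) Filter.atTop (nhds 0) := by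
  have hK0 : 0 ≤ K := by simpa using (abs_nonneg _).trans (hK 0)
  have t := (tendsto_rpow_mul_exp_neg_mul_atTop_nhds_zero (a + 1) 1 one_pos).const_mul K
  rw [mul_zero] at t
  refine squeeze_zero_norm' ?_ t
  filter_upwards [Filter.eventually_ge_atTop 1] with x hx
  have hx0 : 0 < x := by linarith
  have hp := Real.rpow_pos_of_pos hx0 a
  have hl : 1 + |Real.log x| ≤ x := by
    rw [abs_of_nonneg (Real.log_nonneg hx)]
    linarith [Real.log_le_sub_one_of_pos hx0]
  rw [Real.norm_eq_abs, abs_mul, abs_mul, abs_of_pos hp, abs_of_pos (Real.exp_pos _),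
    Real.rpow_add_one hx0.ne']
  calc x ^ a * Real.exp (-x) * |h (Real.log x)| ≤ x ^ a * Real.exp (-x) * (K * x) := by
        gcongr
        exact (hK _).trans (by gcongr)
    _ = _ := by rw [neg_one_mul]; ring

/-- The score identity of the law of `log G` for a gamma variable `G` of shape `a`: its density is
proportional to `exp (a y - e ^ y)`, so that integration by parts gives
`E[(G - a) h(log G)] = E[h'(log G)]`. One exceptional point `c` is allowed, since the derivative of
the solution of Stein's equation jumps there. -/
theorem integral_score_gammaMeasure {a K c : ℝ} (ha : 1 ≤ a) {h h' : ℝ → ℝ} (hc : Continuous h)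
    (hm : Measurable h') (hd : ∀ y, y ≠ c → HasDerivAt h (h' y) y)
    (hK : ∀ y, |h y| ≤ K * (1 + |y|)) (hK' : ∀ y, |h' y| ≤ K * (1 + |y|)) :
    ∫ x, (x - a) * h (Real.log x) ∂(gammaMeasure a 1)
      = ∫ x, h' (Real.log x) ∂(gammaMeasure a 1) := by
  have ha0 : 0 < a := by linarith
  have := isProbabilityMeasure_gammaMeasure ha0 one_pos
  have hL := memLp_comp_of_abs_le (memLp_log_gammaMeasure ha) hc.measurable hK
  have hL' := (memLp_comp_of_abs_le (memLp_log_gammaMeasure ha) hm hK').integrable one_le_two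
  have hX : MemLp (fun x => x - a) 2 (gammaMeasure a 1) :=
    (memLp_id_gammaMeasure ha0).sub (memLp_const a)
  have hI : Integrable (fun x => (x - a) * h (Real.log x)) (gammaMeasure a 1) :=
    hX.integrable_mul hL
  rw [← sub_eq_zero, ← integral_sub hI hL', integral_gammaMeasure ha0]
  simp only [smul_eq_mul, mul_assoc]
  rw [integral_const_mul, mul_eq_zero]
  right
  have hF := (integrable_gammaMeasure_iff ha0).mp (hI.sub hL')
  set Φ : ℝ → ℝ := fun x => x ^ a * Real.exp (-x) * h (Real.log x) with hΦ
  set Φ' : ℝ → ℝ :=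
    fun x => x ^ (a - 1) * Real.exp (-x) * ((x - a) * h (Real.log x) - h' (Real.log x)) with hΦ'
  have hF : IntegrableOn Φ' (Set.Ioi 0) := hF
  have hdΦ : ∀ x, 0 < x → x ≠ Real.exp c → HasDerivAt Φ (-Φ' x) x := by
    intro x hx hxc
    have hlc : Real.log x ≠ c := fun e => hxc (by rw [← e, Real.exp_log hx])
    have h1 := (Real.hasDerivAt_rpow_const (p := a) (Or.inl hx.ne')).mul
      ((hasDerivAt_neg x).exp)
    have h2 := h1.mul ((hd _ hlc).comp x (Real.hasDerivAt_log hx.ne'))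
    convert! h2 using 1
    have hxa : x ^ a = x ^ (a - 1) * x := by
      rw [← Real.rpow_add_one hx.ne', sub_add_cancel]
    simp only [hΦ', hxa, Function.comp, Pi.mul_apply]
    field_simp
    ring
  have hcΦ : ∀ x, 0 < x → ContinuousAt Φ x := by
    intro x hx
    refine ((Real.continuousAt_rpow_const x a (Or.inl hx.ne')).mul (by fun_prop)).mul ?_
    exact hc.continuousAt.comp (Real.continuousAt_log hx.ne')
  have hec := Real.exp_pos c
  -- The fundamental theorem of calculus, on both sides of the exceptional point `exp c`.
  have hF1 : IntegrableOn Φ' (Set.Ioc 0 (Real.exp c)) := hF.mono_set Set.Ioc_subset_Ioi_self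
  have hF2 : IntegrableOn Φ' (Set.Ioi (Real.exp c)) := hF.mono_set (Set.Ioi_subset_Ioi hec.le)
  have i1 : ∫ x in Set.Ioi (Real.exp c), -Φ' x = 0 - Φ (Real.exp c) :=
    integral_Ioi_of_hasDerivAt_of_tendsto (hcΦ _ hec).continuousWithinAt
      (fun x hx => hdΦ x (hec.trans hx) (ne_of_gt hx)) hF2.neg (tendsto_gamma_boundary_atTop hK)
  have i2 : ∫ x in (0)..(Real.exp c), -Φ' x = Φ (Real.exp c) - Φ 0 := by
    refine intervalIntegral.integral_eq_sub_of_hasDerivAt_of_le hec.le ?_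
      (fun x hx => hdΦ x hx.1 (ne_of_lt hx.2)) ?_
    · intro x hx
      rcases hx.1.eq_or_lt with rfl | hx0
      · have h0 : Φ 0 = 0 := by simp [hΦ, Real.zero_rpow ha0.ne']
        have : ContinuousWithinAt Φ (Set.Ioi 0) 0 := by
          rw [ContinuousWithinAt, h0]
          exact tendsto_gamma_boundary_zero ha hK
        exact (continuousWithinAt_Ioi_iff_Ici.mp this).mono Set.Icc_subset_Ici_self
      · exact (hcΦ x hx0).continuousWithinAt
    · rw [intervalIntegrable_iff_integrableOn_Ioc_of_le hec.le]
      exact hF1.neg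
  have h0 : Φ 0 = 0 := by simp [hΦ, Real.zero_rpow ha0.ne']
  rw [intervalIntegral.integral_of_le hec.le, integral_neg, h0] at i2
  rw [integral_neg] at i1
  have hu := setIntegral_union (Set.Ioc_disjoint_Ioi (a := (0 : ℝ)) le_rfl) measurableSet_Ioi
    hF1 hF2
  rw [Set.Ioc_union_Ioi_eq_Ioi hec.le] at hu
  have : ∫ x in Set.Ioi 0, Φ' x = 0 := by rw [hu]; linarith
  simpa only [hΦ', mul_assoc] using this

/-! ### Stein's equation for the standard normal law -/

theorem integrable_exp_neg_sq_half : Integrable fun t : ℝ => Real.exp (-t ^ 2 / 2) := by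
  refine (integrable_exp_neg_mul_sq (b := 1 / 2) (by norm_num)).congr
    (Filter.Eventually.of_forall fun t => ?_)
  dsimp only
  congr 1
  ring

theorem integral_exp_neg_sq_half : ∫ t : ℝ, Real.exp (-t ^ 2 / 2) = √(2 * Real.pi) := by
  have h := integral_gaussian (1 / 2)
  rw [show Real.pi / (1 / 2) = 2 * Real.pi by ring] at h
  rw [← h]
  congr with t
  congr 1
  ring

theorem gaussianReal_Iic_eq (x : ℝ) :
    √(2 * Real.pi) * (gaussianReal 0 1).real (Set.Iic x)
      = ∫ t in Set.Iic x, Real.exp (-t ^ 2 / 2) := by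
  have hpos : 0 < √(2 * Real.pi) := by positivity
  rw [measureReal_def, gaussianReal_apply_eq_integral 0 one_ne_zero,
    ENNReal.toReal_ofReal (integral_nonneg fun t => gaussianPDFReal_nonneg 0 1 t),
    ← integral_const_mul]
  congr with t
  simp only [gaussianPDFReal, NNReal.coe_one, mul_one, sub_zero]
  field_simp

/-- A crude form of the Mills ratio bound, for half-lines `s` that start at `w` and point away from
the origin. -/
theorem exp_sq_half_mul_setIntegral_le {s : Set ℝ} (hs : MeasurableSet s) {w : ℝ}
    (h : ∀ t ∈ s, (t - w) ^ 2 ≤ t ^ 2 - w ^ 2) :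
    Real.exp (w ^ 2 / 2) * ∫ t in s, Real.exp (-t ^ 2 / 2) ≤ √(2 * Real.pi) := by
  have hi : Integrable fun t : ℝ => Real.exp (-(t - w) ^ 2 / 2) :=
    integrable_exp_neg_sq_half.comp_sub_right w
  rw [← integral_exp_neg_sq_half,
    ← integral_sub_right_eq_self (μ := volume) (fun t => Real.exp (-t ^ 2 / 2)) w,
    ← integral_const_mul]
  calc ∫ t in s, Real.exp (w ^ 2 / 2) * Real.exp (-t ^ 2 / 2)
      ≤ ∫ t in s, Real.exp (-(t - w) ^ 2 / 2) := by
        refine setIntegral_mono_on (integrable_exp_neg_sq_half.integrableOn.const_mul _)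
          hi.integrableOn hs fun t ht => ?_
        rw [← Real.exp_add, Real.exp_le_exp]
        linarith [h t ht]
    _ ≤ _ := setIntegral_le_integral hi (Filter.Eventually.of_forall fun t => (Real.exp_pos _).le)

/-- Stein's equation `f' w - w f w = 1_{w ≤ x} - Φ(x)` has a bounded continuous solution, namely
`f w = exp (w² / 2) ∫_{t ≤ w} (1_{t ≤ x} - Φ(x)) exp (-t² / 2) dt`. As the integrand has total
integral zero, the integral may be taken over `t > w` instead when `w ≥ 0`. -/
theorem exists_stein_solution (x : ℝ) : ∃ f : ℝ → ℝ, Continuous f ∧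
    (∀ w, |f w| ≤ √(2 * Real.pi)) ∧
    ∀ w, w ≠ x → HasDerivAt f
      (w * f w + ((Set.Iic x).indicator 1 w - (gaussianReal 0 1).real (Set.Iic x))) w := by
  set p := (gaussianReal 0 1).real (Set.Iic x) with hp
  set q : ℝ → ℝ := fun w => (Set.Iic x).indicator 1 w - p with hq
  set g : ℝ → ℝ := fun t => q t * Real.exp (-t ^ 2 / 2) with hg
  have hp0 : 0 ≤ p := measureReal_nonneg
  have hp1 : p ≤ 1 := measureReal_le_one
  have hqm : Measurable q := by
    have : Measurable ((Set.Iic x).indicator (1 : ℝ → ℝ)) :=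
      measurable_one.indicator measurableSet_Iic
    fun_prop
  have hq1 : ∀ t, |q t| ≤ 1 := by
    intro t
    simp only [hq, Set.indicator_apply, Pi.one_apply]
    split_ifs <;> rw [abs_le] <;> constructor <;> linarith
  have hgle : ∀ t, |g t| ≤ Real.exp (-t ^ 2 / 2) := by
    intro t
    rw [hg, abs_mul, abs_of_pos (Real.exp_pos _)]
    exact mul_le_of_le_one_left (Real.exp_pos _).le (hq1 t)
  have hgi : Integrable g :=
    integrable_exp_neg_sq_half.mono' (by fun_prop) (Filter.Eventually.of_forall hgle)
  have hg0 : ∫ t, g t = 0 := by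
    have e : ∀ t, g t = (Set.Iic x).indicator (fun t => Real.exp (-t ^ 2 / 2)) t
        - p * Real.exp (-t ^ 2 / 2) := by
      intro t
      simp only [hg, hq, Set.indicator_apply, Pi.one_apply]
      split_ifs <;> ring
    simp_rw [e]
    rw [integral_sub (integrable_exp_neg_sq_half.indicator measurableSet_Iic)
      (integrable_exp_neg_sq_half.const_mul p), integral_indicator measurableSet_Iic,
      integral_const_mul, integral_exp_neg_sq_half, ← gaussianReal_Iic_eq]
    ring
  have hbound : ∀ (s : Set ℝ), |∫ t in s, g t| ≤ ∫ t in s, Real.exp (-t ^ 2 / 2) := fun s => by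
    rw [← Real.norm_eq_abs]
    exact norm_integral_le_of_norm_le integrable_exp_neg_sq_half.integrableOn
      (Filter.Eventually.of_forall hgle)
  set G : ℝ → ℝ := fun w => ∫ t in Set.Iic w, g t with hG
  have hGx : ∀ w, G w = G 0 + ∫ t in (0)..w, g t := by
    intro w
    have := intervalIntegral.integral_Iic_sub_Iic (a := 0) (b := w) hgi.integrableOn hgi.integrableOn
    simp only [hG]
    linarith
  have hGc : Continuous G := by
    have h := intervalIntegral.continuous_primitive (fun a b => hgi.intervalIntegrable) 0
    rw [show G = fun w => G 0 + ∫ t in (0)..w, g t from funext hGx]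
    fun_prop
  have hGd : ∀ w, w ≠ x → HasDerivAt G (g w) w := by
    intro w hw
    have hqc : ContinuousAt q w := by
      refine ContinuousAt.sub ?_ continuousAt_const
      refine ContinuousOn.continuousAt_indicator (s := Set.Iic x) ?_ ?_ <;> simp
      · exact continuousOn_const
      · exact hw
    have hgc : ContinuousAt g w := hqc.mul (by fun_prop)
    have h := intervalIntegral.integral_hasDerivAt_right (hgi.intervalIntegrable (a := 0) (b := w))
      (hgi.aestronglyMeasurable.stronglyMeasurableAtFilter) hgc
    rw [show G = fun w => G 0 + ∫ t in (0)..w, g t from funext hGx]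
    exact h.const_add (G 0)
  refine ⟨fun w => Real.exp (w ^ 2 / 2) * G w, by fun_prop, fun w => ?_, fun w hw => ?_⟩
  · rw [abs_mul, abs_of_pos (Real.exp_pos _)]
    rcases le_total w 0 with h | h
    · refine le_trans ?_ (exp_sq_half_mul_setIntegral_le (s := Set.Iic w) (w := w)
        measurableSet_Iic fun t ht => ?_)
      · gcongr
        exact hbound _
      · have : t ≤ w := ht
        nlinarith
    · refine le_trans ?_ (exp_sq_half_mul_setIntegral_le (s := Set.Ioi w) (w := w)
        measurableSet_Ioi fun t ht => ?_)
      · gcongr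
        have := intervalIntegral.integral_Iic_add_Ioi (b := w) hgi.integrableOn hgi.integrableOn
        rw [hg0] at this
        have e : G w = -∫ t in Set.Ioi w, g t := by simp only [hG]; linarith
        rw [e, abs_neg]
        exact hbound _
      · have : w < t := ht
        nlinarith
  · have h1 : HasDerivAt (fun w : ℝ => Real.exp (w ^ 2 / 2)) (Real.exp (w ^ 2 / 2) * w) w := by
      convert! ((hasDerivAt_pow 2 w).div_const 2).exp using 1
      simp
    convert! h1.mul (hGd w hw) using 1
    have : Real.exp (w ^ 2 / 2) * Real.exp (-w ^ 2 / 2) = 1 := by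
      rw [← Real.exp_add, ← Real.exp_zero]; congr 1; ring
    simp only [hg]
    linear_combination (-q w) * this

/-! ### Normal approximation of sums of logarithms of gamma variables -/

theorem memLp_comp_eval_pi {a : ℝ} (ha : 0 < a) {N : ℕ} (i : Fin N) {z : ℝ → ℝ}
    (hz : MemLp z 2 (gammaMeasure a 1)) :
    MemLp (fun g : Fin N → ℝ => z (g i)) 2 (Measure.pi fun _ : Fin N => gammaMeasure a 1) := by
  have := isProbabilityMeasure_gammaMeasure ha one_pos
  exact hz.comp_measurePreserving (measurePreserving_eval (fun _ : Fin N => gammaMeasure a 1) i)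

theorem memLp_sum_pi {a : ℝ} (ha : 0 < a) {N : ℕ} {z : ℝ → ℝ}
    (hz : MemLp z 2 (gammaMeasure a 1)) :
    MemLp (fun g : Fin N → ℝ => ∑ i, z (g i)) 2
      (Measure.pi fun _ : Fin N => gammaMeasure a 1) :=
  memLp_finsetSum _ fun i _ => memLp_comp_eval_pi ha i hz

/-- The score identity for a sum of logarithms of independent gamma variables: by Fubini, the
one-dimensional identity is applied to the `i`-th variable with the others fixed. -/
theorem integral_score_pi_gammaMeasure {a K c : ℝ} (ha : 1 ≤ a) {N : ℕ} (i : Fin N)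
    {f f' : ℝ → ℝ} (hc : Continuous f)
    (hm : Measurable f') (hd : ∀ y, y ≠ c → HasDerivAt f (f' y) y)
    (hK : ∀ y, |f y| ≤ K * (1 + |y|)) (hK' : ∀ y, |f' y| ≤ K * (1 + |y|)) :
    ∫ g, (g i - a) * f (∑ j, Real.log (g j)) ∂(Measure.pi fun _ : Fin N => gammaMeasure a 1)
      = ∫ g, f' (∑ j, Real.log (g j)) ∂(Measure.pi fun _ : Fin N => gammaMeasure a 1) := by
  have ha0 : 0 < a := by linarith
  have := isProbabilityMeasure_gammaMeasure ha0 one_pos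
  have hK0 : 0 ≤ K := by simpa using (abs_nonneg _).trans (hK 0)
  obtain ⟨m, rfl⟩ : ∃ m, N = m + 1 := ⟨N - 1, by have := i.pos; omega⟩
  have hS := memLp_sum_pi (N := m + 1) ha0 (memLp_log_gammaMeasure ha)
  have hX : MemLp (fun x => x - a) 2 (gammaMeasure a 1) :=
    (memLp_id_gammaMeasure ha0).sub (memLp_const a)
  have hI : Integrable (fun g : Fin (m + 1) → ℝ => (g i - a) * f (∑ j, Real.log (g j)))
      (Measure.pi fun _ => gammaMeasure a 1) :=
    (memLp_comp_eval_pi ha0 i hX).integrable_mul (memLp_comp_of_abs_le hS hc.measurable hK)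
  have hI' : Integrable (fun g : Fin (m + 1) → ℝ => f' (∑ j, Real.log (g j)))
      (Measure.pi fun _ => gammaMeasure a 1) :=
    (memLp_comp_of_abs_le hS hm hK').integrable one_le_two
  have hmp := measurePreserving_piFinSuccAbove (fun _ : Fin (m + 1) => gammaMeasure a 1) i
  set e := MeasurableEquiv.piFinSuccAbove (fun _ : Fin (m + 1) => ℝ) i
  set ν := gammaMeasure a 1
  set F : ℝ × (Fin m → ℝ) → ℝ := fun p =>
    (p.1 - a) * f (Real.log p.1 + ∑ j, Real.log (p.2 j)) with hF
  set F' : ℝ × (Fin m → ℝ) → ℝ := fun p => f' (Real.log p.1 + ∑ j, Real.log (p.2 j)) with hF'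
  have e1 : (fun g : Fin (m + 1) → ℝ => (g i - a) * f (∑ j, Real.log (g j))) = fun g => F (e g) := by
    ext g
    rw [Fin.sum_univ_succAbove _ i]
    rfl
  have e2 : (fun g : Fin (m + 1) → ℝ => f' (∑ j, Real.log (g j))) = fun g => F' (e g) := by
    ext g
    rw [Fin.sum_univ_succAbove _ i]
    rfl
  rw [e1] at hI ⊢
  rw [e2] at hI' ⊢
  rw [hmp.integral_comp' F, hmp.integral_comp' F',
    integral_prod_symm _ ((hmp.integrable_comp_emb e.measurableEmbedding (g := F)).mp hI),
    integral_prod_symm _ ((hmp.integrable_comp_emb e.measurableEmbedding (g := F')).mp hI')]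
  congr with r
  set b := ∑ j, Real.log (r j)
  have hgrow : ∀ y, K * (1 + |y + b|) ≤ K * (1 + |b|) * (1 + |y|) := by
    intro y
    have := abs_add_le y b
    have h2 := mul_nonneg (abs_nonneg y) (abs_nonneg b)
    rw [mul_assoc]
    gcongr
    nlinarith
  exact integral_score_gammaMeasure (c := c - b) ha (h := fun y => f (y + b))
    (h' := fun y => f' (y + b)) (by fun_prop) (by fun_prop)
    (fun y hy => (hd (y + b) (fun h => hy (by linarith))).comp_add_const y b)
    (fun y => (hK _).trans (hgrow y)) (fun y => (hK' _).trans (hgrow y))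

/-- The score identity for the identity function. -/
theorem covariance_id_log_gammaMeasure {a : ℝ} (ha : 1 ≤ a) :
    covariance (fun x => x) Real.log (gammaMeasure a 1) = 1 := by
  have ha0 : 0 < a := by linarith
  have := isProbabilityMeasure_gammaMeasure ha0 one_pos
  have hl := memLp_log_gammaMeasure ha
  have hX : MemLp (fun x => x - a) 2 (gammaMeasure a 1) :=
    (memLp_id_gammaMeasure ha0).sub (memLp_const a)
  have hi : Integrable (fun x : ℝ => x) (gammaMeasure a 1) :=
    (memLp_id_gammaMeasure ha0).integrable one_le_two
  have h := integral_score_gammaMeasure (K := 1) (c := 0) ha (h := fun y => y) (h' := fun _ => 1)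
    continuous_id measurable_const (fun y _ => hasDerivAt_id y) (fun y => by linarith)
    (fun y => by simp)
  have hI : Integrable (fun x => (x - a) * Real.log x) (gammaMeasure a 1) := hX.integrable_mul hl
  rw [covariance, integral_id_gammaMeasure ha0]
  simp only [mul_sub]
  rw [integral_sub hI ((hX.integrable one_le_two).mul_const _), h, integral_mul_const,
    integral_sub hi (integrable_const a), integral_id_gammaMeasure ha0]
  simp

theorem variance_linear_gammaMeasure {a : ℝ} (ha : 1 ≤ a) (c d : ℝ) :
    variance (fun x => c * x - d * Real.log x) (gammaMeasure a 1)
      = c ^ 2 * a - 2 * (c * d) + d ^ 2 * variance Real.log (gammaMeasure a 1) := by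
  have ha0 : 0 < a := by linarith
  have := isProbabilityMeasure_gammaMeasure ha0 one_pos
  have h := variance_sub ((memLp_id_gammaMeasure ha0).const_mul c)
    ((memLp_log_gammaMeasure ha).const_mul d)
  rw [variance_const_mul, variance_const_mul, covariance_const_mul_left,
    covariance_const_mul_right, covariance_id_log_gammaMeasure ha,
    variance_id_gammaMeasure ha0, mul_one] at h
  exact h

/-- The variance of `G / a - log G` is `Var[log G] - 1 / a`, and it is nonnegative. -/
theorem one_le_mul_variance_log_gammaMeasure {a : ℝ} (ha : 1 ≤ a) :
    1 ≤ a * variance Real.log (gammaMeasure a 1) := by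
  have h := variance_linear_gammaMeasure ha a⁻¹ 1
  have h0 := variance_nonneg (fun x => a⁻¹ * x - 1 * Real.log x) (gammaMeasure a 1)
  have ha0 : 0 < a := by linarith
  have e : a⁻¹ ^ 2 * a = a⁻¹ := by field_simp
  rw [h, e] at h0
  have : a⁻¹ ≤ variance Real.log (gammaMeasure a 1) := by linarith
  calc 1 = a * a⁻¹ := (mul_inv_cancel₀ ha0.ne').symm
    _ ≤ _ := by gcongr

theorem integral_abs_le_sqrt {Ω : Type*} [MeasurableSpace Ω] {P : Measure Ω}
    [IsProbabilityMeasure P] {Z : Ω → ℝ} (hZ : MemLp Z 2 P) (h0 : ∫ ω, Z ω ∂P = 0) :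
    ∫ ω, |Z ω| ∂P ≤ √(variance Z P) := by
  apply Real.le_sqrt_of_sq_le
  have h := variance_nonneg (fun ω => |Z ω|) P
  rw [variance_eq_sub (X := fun ω => |Z ω|) hZ.abs] at h
  rw [variance_of_integral_eq_zero hZ.aemeasurable h0]
  simpa using h

theorem gaussianReal_Iic_standardize {m v s : ℝ} (hs : 0 < s) (hv : s ^ 2 = v) (x : ℝ) :
    (gaussianReal m v.toNNReal).real (Set.Iic x)
      = (gaussianReal 0 1).real (Set.Iic ((x - m) / s)) := by
  have h : gaussianReal m v.toNNReal = (gaussianReal 0 1).map (fun z => s * z + m) := by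
    rw [← Function.comp_def (fun z => z + m) (fun z => s * z),
      ← Measure.map_map (by fun_prop) (by fun_prop), gaussianReal_map_const_mul,
      gaussianReal_map_add_const]
    congr 1
    · simp
    · ext
      rw [← hv]
      simp [sq_nonneg]
  rw [h, map_measureReal_apply (by fun_prop) measurableSet_Iic]
  congr 1
  ext z
  simp only [Set.mem_preimage, Set.mem_Iic]
  rw [le_div_iff₀ hs, le_sub_iff_add_le, mul_comm]

/-- A quantitative central limit theorem for `S = ∑ log G_j` with `G_j` independent gamma variables
of shape `a`. Let `W = (S - E S) / s` with `s² = N v` be the normalised sum, and let `f` solve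
Stein's equation at the normalised point. The score identity rewrites `E[f'(W)]` as
`E[(s / N) ∑ (G_j - a) f(W)]`, so that the difference of the distribution functions is `E[Z f(W)]`
with `Z = (s / N) ∑ (G_j - a) - W`, and the variance of `Z` is exactly `a v - 1`. -/
theorem abs_cdf_sum_log_gamma_sub_le {a : ℝ} (ha : 1 ≤ a) {N : ℕ} (hN : 1 ≤ N) (x : ℝ) :
    |(Measure.pi fun _ : Fin N => gammaMeasure a 1).real {g | ∑ j, Real.log (g j) ≤ x} -
      (gaussianReal (N * ∫ y, Real.log y ∂(gammaMeasure a 1))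
        (Real.toNNReal (N * variance Real.log (gammaMeasure a 1)))).real (Set.Iic x)|
    ≤ √(2 * Real.pi) * √(a * variance Real.log (gammaMeasure a 1) - 1) := by
  have ha0 : 0 < a := by linarith
  have hN0 : (0 : ℝ) < N := by exact_mod_cast hN
  have := isProbabilityMeasure_gammaMeasure ha0 one_pos
  have hav := one_le_mul_variance_log_gammaMeasure ha
  set v := variance Real.log (gammaMeasure a 1) with hv
  set μ := ∫ y, Real.log y ∂(gammaMeasure a 1) with hμ
  set P := Measure.pi fun _ : Fin N => gammaMeasure a 1 with hP
  have hv0 : 0 < v := by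
    by_contra h
    nlinarith
  set s := √(N * v) with hs
  have hs0 : 0 < s := Real.sqrt_pos.mpr (by positivity)
  have hs2 : s ^ 2 = N * v := Real.sq_sqrt (by positivity)
  rw [gaussianReal_Iic_standardize hs0 hs2]
  set x' := (x - N * μ) / s with hx'
  set p := (gaussianReal 0 1).real (Set.Iic x') with hp
  obtain ⟨f, hfc, hfb, hfd⟩ := exists_stein_solution x'
  set k : ℝ → ℝ := fun w => (Set.Iic x').indicator 1 w - p with hk
  set W : (Fin N → ℝ) → ℝ := fun g => (∑ j, Real.log (g j) - N * μ) / s with hW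
  -- One summand of the difference `Z` between the normalised score and the normalised sum.
  set z : ℝ → ℝ := fun y => (s / N * y - s⁻¹ * Real.log y) - (s / N * a - s⁻¹ * μ) with hz
  have hX := memLp_id_gammaMeasure ha0
  have hl := memLp_log_gammaMeasure ha
  have hz2 : MemLp z 2 (gammaMeasure a 1) :=
    ((hX.const_mul (s / N)).sub (hl.const_mul s⁻¹)).sub (memLp_const _)
  have hz0 : ∫ y, z y ∂(gammaMeasure a 1) = 0 := by
    have h1 : Integrable (fun y : ℝ => s / N * y) (gammaMeasure a 1) :=
      (hX.integrable one_le_two).const_mul _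
    have h2 : Integrable (fun y : ℝ => s⁻¹ * Real.log y) (gammaMeasure a 1) :=
      (hl.integrable one_le_two).const_mul _
    have h3 : Integrable (fun y : ℝ => s / N * y - s⁻¹ * Real.log y) (gammaMeasure a 1) :=
      h1.sub h2
    rw [hz, integral_sub h3 (integrable_const _), integral_sub h1 h2, integral_const_mul,
      integral_const_mul, integral_id_gammaMeasure ha0]
    simp [hμ]
  have hzv : variance z (gammaMeasure a 1) = (a * v - 1) / N := by
    rw [hz, variance_sub_const (by fun_prop), variance_linear_gammaMeasure ha, ← hv, inv_pow,
      div_pow, hs2]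
    field_simp
    ring
  set Z : (Fin N → ℝ) → ℝ := fun g => ∑ j, z (g j) with hZ
  have hZ2 : MemLp Z 2 P := memLp_sum_pi ha0 hz2
  have hZ0 : ∫ g, Z g ∂P = 0 := by
    rw [hZ, integral_finsetSum _ fun i _ => (memLp_comp_eval_pi ha0 i hz2).integrable one_le_two]
    refine Finset.sum_eq_zero fun i _ => ?_
    rw [integral_comp_eval (μ := fun _ : Fin N => gammaMeasure a 1) (f := z)
      hz2.aestronglyMeasurable, hz0]
  have hZv : variance Z P = a * v - 1 := by
    have h := variance_sum_pi (μ := fun _ : Fin N => gammaMeasure a 1) (X := fun _ => z)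
      fun _ => hz2
    have e : Z = ∑ i : Fin N, fun g : Fin N → ℝ => z (g i) := by ext g; simp [hZ]
    rw [e, h, hzv]
    simp
    field_simp
  have hS2 : MemLp (fun g : Fin N → ℝ => ∑ j, Real.log (g j)) 2 P := memLp_sum_pi ha0 hl
  have hW2 : MemLp W 2 P := by
    have : MemLp (fun g : Fin N → ℝ => s⁻¹ * (∑ j, Real.log (g j) - N * μ)) 2 P :=
      (hS2.sub (memLp_const _)).const_mul s⁻¹
    simpa only [hW, div_eq_inv_mul] using this
  have hkm : Measurable k :=
    (measurable_one.indicator measurableSet_Iic).sub measurable_const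
  have hp0 : 0 ≤ p := measureReal_nonneg
  have hp1 : p ≤ 1 := measureReal_le_one
  have hk1 : ∀ w, |k w| ≤ 1 := by
    intro w
    simp only [hk, Set.indicator_apply, Pi.one_apply]
    split_ifs <;> rw [abs_le] <;> constructor <;> linarith
  set B := √(2 * Real.pi) with hB
  have hB0 : 0 ≤ B := Real.sqrt_nonneg _
  set f' : ℝ → ℝ := fun w => w * f w + k w with hf'
  have hf'm : Measurable f' := by
    have := hfc.measurable
    fun_prop
  have hgb : ∀ w, |f w| ≤ (B + 1) * (1 + |w|) := fun w => by
    nlinarith [hfb w, abs_nonneg w]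
  have hgb' : ∀ w, |f' w| ≤ (B + 1) * (1 + |w|) := fun w => by
    have h1 := abs_add_le (w * f w) (k w)
    have h2 := mul_le_mul_of_nonneg_left (hfb w) (abs_nonneg w)
    rw [abs_mul] at h1
    have h3 := hk1 w
    have h4 := abs_nonneg w
    simp only [hf']
    nlinarith
  have hfW : MemLp (fun g => f (W g)) 2 P := memLp_comp_of_abs_le hW2 hfc.measurable hgb
  have hWfW : Integrable (fun g => W g * f (W g)) P := hW2.integrable_mul hfW
  have hkW : Integrable (fun g => k (W g)) P :=
    (memLp_comp_of_abs_le (K := 1) hW2 hkm fun w => by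
      linarith [hk1 w, abs_nonneg w]).integrable one_le_two
  set M := |N * μ| with hM
  have hM0 : 0 ≤ M := abs_nonneg _
  have hwy : ∀ y, (B + 1) * (1 + |(y - N * μ) / s|)
      ≤ (B + 1) * (1 + (1 + M) / s) * (1 + |y|) := by
    intro y
    have h1 : |y - N * μ| ≤ |y| + M := abs_sub _ _
    have h2 : |y| + M ≤ (1 + M) * (1 + |y|) := by nlinarith [abs_nonneg y]
    have h3 : |(y - N * μ) / s| ≤ (1 + M) / s * (1 + |y|) := by
      rw [abs_div, abs_of_pos hs0, div_mul_eq_mul_div]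
      gcongr
      exact h1.trans h2
    rw [mul_assoc]
    gcongr
    nlinarith [abs_nonneg y]
  -- A common constant of linear growth for `f ((y - N μ) / s)` and its derivative in `y`.
  set K := (B + 1) * (1 + (1 + M) / s) * (1 + s⁻¹) with hK
  have hscore : ∀ i : Fin N, ∫ g, (g i - a) * f (W g) ∂P = ∫ g, f' (W g) / s ∂P := by
    intro i
    have hs0' : 0 ≤ s⁻¹ := by positivity
    refine integral_score_pi_gammaMeasure (c := x) (K := K) ha i
      (f := fun y => f ((y - N * μ) / s)) (f' := fun y => f' ((y - N * μ) / s) / s)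
      (by fun_prop) (by fun_prop) (fun y hy => ?_) (fun y => ?_) (fun y => ?_)
    · have h1 : HasDerivAt (fun y : ℝ => (y - N * μ) / s) (1 / s) y :=
        ((hasDerivAt_id y).sub_const _).div_const s
      have hne : (y - N * μ) / s ≠ x' := by
        intro h
        rw [hx', div_left_inj' hs0.ne'] at h
        exact hy (by linarith)
      convert! (hfd _ hne).comp y h1 using 1
      simp only [hf', hk]
      ring
    · refine ((hgb _).trans (hwy y)).trans ?_
      have h1 : 0 ≤ (B + 1) * (1 + (1 + M) / s) := by positivity
      exact mul_le_mul_of_nonneg_right (le_mul_of_one_le_right h1 (by linarith)) (by positivity)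
    · rw [abs_div, abs_of_pos hs0, div_eq_mul_inv]
      calc |f' ((y - N * μ) / s)| * s⁻¹
          ≤ (B + 1) * (1 + (1 + M) / s) * (1 + |y|) * (1 + s⁻¹) := by
            gcongr
            · exact (hgb' _).trans (hwy y)
            · linarith
        _ = K * (1 + |y|) := by rw [hK]; ring
  have hgi : ∀ i : Fin N, Integrable (fun g => (g i - a) * f (W g)) P := fun i =>
    (memLp_comp_eval_pi ha0 i (z := fun y => y - a) (hX.sub (memLp_const a))).integrable_mul hfW
  have hsplit : ∀ g, Z g * f (W g)
      = s / N * ∑ i, (g i - a) * f (W g) - W g * f (W g) := by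
    intro g
    have : Z g = s / N * ∑ i, (g i - a) - W g := by
      simp only [hZ, hz, hW, Finset.sum_sub_distrib, ← Finset.mul_sum, Finset.sum_const,
        Finset.card_univ, Fintype.card_fin, nsmul_eq_mul]
      field_simp
      ring
    rw [this, ← Finset.sum_mul]
    ring
  have hmain : ∫ g, Z g * f (W g) ∂P = ∫ g, k (W g) ∂P := by
    simp_rw [hsplit]
    rw [integral_sub ((integrable_finsetSum _ fun i _ => hgi i).const_mul _) hWfW,
      integral_const_mul, integral_finsetSum _ fun i _ => hgi i]
    simp_rw [hscore]
    rw [Finset.sum_const, Finset.card_univ, Fintype.card_fin, nsmul_eq_mul, integral_div]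
    simp only [hf']
    rw [integral_add hWfW hkW]
    field_simp
    ring
  have hset : ∫ g, k (W g) ∂P = P.real {g | ∑ j, Real.log (g j) ≤ x} - p := by
    have hms : MeasurableSet {g : Fin N → ℝ | ∑ j, Real.log (g j) ≤ x} :=
      measurableSet_le (by fun_prop) measurable_const
    have e : ∀ g, k (W g) = {g : Fin N → ℝ | ∑ j, Real.log (g j) ≤ x}.indicator 1 g - p := by
      intro g
      have : W g ≤ x' ↔ ∑ j, Real.log (g j) ≤ x := by
        simp only [hW, hx']
        rw [div_le_div_iff_of_pos_right hs0, sub_le_sub_iff_right]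
      simp only [hk, Set.indicator_apply, Set.mem_Iic, this, Set.mem_ofPred_eq, Pi.one_apply]
    simp_rw [e]
    have hi : Integrable
        ({g : Fin N → ℝ | ∑ j, Real.log (g j) ≤ x}.indicator (1 : (Fin N → ℝ) → ℝ)) P :=
      (integrable_const (1 : ℝ)).indicator hms
    rw [integral_sub hi (integrable_const p), integral_indicator_one hms]
    simp
  rw [← hset, ← hmain, ← hZv]
  have hZi : Integrable (fun g => |Z g|) P := (hZ2.integrable one_le_two).abs
  calc |∫ g, Z g * f (W g) ∂P| ≤ ∫ g, |Z g| * B ∂P := by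
        rw [← Real.norm_eq_abs]
        refine norm_integral_le_of_norm_le (hZi.mul_const B)
          (Filter.Eventually.of_forall fun g => ?_)
        rw [Real.norm_eq_abs, abs_mul]
        gcongr
        exact hfb _
    _ = B * ∫ g, |Z g| ∂P := by rw [integral_mul_const, mul_comm]
    _ ≤ B * √(variance Z P) := by
        gcongr
        exact integral_abs_le_sqrt hZ2 hZ0

/-! ### The mean of the logarithm of a gamma variable -/

/-- The recurrence `ψ(a + 1) = ψ(a) + 1 / a` of the digamma function. The law of shape `a + 1` has
density `x / a` with respect to that of shape `a`, and `E[G log G]` is known from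
`covariance_id_log_gammaMeasure`. -/
theorem integral_log_gammaMeasure_add_one {a : ℝ} (ha : 1 ≤ a) :
    ∫ x, Real.log x ∂(gammaMeasure (a + 1) 1) = ∫ x, Real.log x ∂(gammaMeasure a 1) + a⁻¹ := by
  have ha0 : 0 < a := by linarith
  have := isProbabilityMeasure_gammaMeasure ha0 one_pos
  have hl := memLp_log_gammaMeasure ha
  have hX := memLp_id_gammaMeasure ha0
  have hc := covariance_id_log_gammaMeasure ha
  rw [covariance_eq_sub hX hl, integral_id_gammaMeasure ha0] at hc
  have h : ∫ x, Real.log x ∂(gammaMeasure (a + 1) 1)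
      = a⁻¹ * ∫ x, x * Real.log x ∂(gammaMeasure a 1) := by
    rw [integral_gammaMeasure (by linarith), integral_gammaMeasure ha0, ← integral_const_mul]
    refine setIntegral_congr_fun measurableSet_Ioi fun x hx => ?_
    have hx : 0 < x := hx
    have hxa : x ^ a = x ^ (a - 1) * x := by
      rw [← Real.rpow_add_one hx.ne', sub_add_cancel]
    simp only [smul_eq_mul, add_sub_cancel_right, Real.Gamma_add_one ha0.ne', hxa, mul_inv]
    ring
  have hc' : ∫ x, x * Real.log x ∂(gammaMeasure a 1)
      = 1 + a * ∫ x, Real.log x ∂(gammaMeasure a 1) := by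
    have : ∫ x, ((fun x : ℝ => x) * Real.log) x ∂(gammaMeasure a 1)
        = ∫ x, x * Real.log x ∂(gammaMeasure a 1) := rfl
    rw [this] at hc
    linarith
  rw [h, hc']
  field_simp
  ring

theorem tendsto_integral_log_gammaMeasure_sub_log :
    Filter.Tendsto (fun n : ℕ => ∫ x, Real.log x ∂(gammaMeasure n 1) - Real.log n)
      Filter.atTop (nhds 0) := by
  have ht : Filter.Tendsto (fun n : ℕ => √(((n : ℝ) - 1)⁻¹)) Filter.atTop (nhds 0) := by
    have h1 : Filter.Tendsto (fun n : ℕ => ((n : ℝ) - 1)⁻¹) Filter.atTop (nhds 0) :=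
      (Filter.tendsto_atTop_add_const_right _ (-1)
        tendsto_natCast_atTop_atTop).inv_tendsto_atTop
    simpa using h1.sqrt
  refine squeeze_zero_norm' ?_ ht
  filter_upwards [Filter.eventually_gt_atTop 1] with n hn
  have hn1 : (1 : ℝ) < n := by exact_mod_cast hn
  have hn0 : (0 : ℝ) < n := by linarith
  have := isProbabilityMeasure_gammaMeasure hn0 one_pos
  have hl := memLp_log_gammaMeasure hn1.le
  have hY : MemLp (fun x => Real.log (x / n)) 2 (gammaMeasure n 1) := by
    refine (hl.sub (memLp_const (Real.log n))).ae_eq ?_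
    filter_upwards [ae_pos_gammaMeasure n] with x hx
    simp [Real.log_div hx.ne' hn0.ne']
  have he : ∫ x, Real.log (x / n) ∂(gammaMeasure n 1)
      = ∫ x, Real.log x ∂(gammaMeasure n 1) - Real.log n := by
    have : ∫ x, (Real.log x - Real.log n) ∂(gammaMeasure n 1)
        = ∫ x, Real.log x ∂(gammaMeasure n 1) - Real.log n := by
      rw [integral_sub (hl.integrable one_le_two) (integrable_const _)]
      simp
    rw [← this]
    refine integral_congr_ae ?_
    filter_upwards [ae_pos_gammaMeasure n] with x hx
    exact Real.log_div hx.ne' hn0.ne'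
  have hv := variance_nonneg (fun x => Real.log (x / n)) (gammaMeasure n 1)
  rw [variance_eq_sub hY, he] at hv
  have hle := integral_sq_log_div_le hn1
  rw [Real.norm_eq_abs]
  apply Real.abs_le_sqrt
  simp only [Pi.pow_apply] at hv
  linarith

/-- The sequence `ψ(n) - log n + 1 / (2n)` increases and tends to `0`. -/
theorem integral_log_gammaMeasure_le {n : ℕ} (hn : 1 ≤ n) :
    ∫ x, Real.log x ∂(gammaMeasure n 1) - Real.log n ≤ -(1 / (2 * n)) := by
  set u : ℕ → ℝ := fun k =>
    (∫ x, Real.log x ∂(gammaMeasure (k + 1 : ℕ) 1) - Real.log (k + 1 : ℕ))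
      + 1 / (2 * ((k + 1 : ℕ) : ℝ)) with hu
  have hm : Monotone u := by
    refine monotone_nat_of_le_succ fun k => ?_
    have hk : (1 : ℝ) ≤ (k + 1 : ℕ) := by exact_mod_cast Nat.le_add_left 1 k
    have hr := integral_log_gammaMeasure_add_one hk
    simp only [hu, Nat.cast_succ (k + 1), hr]
    set r : ℝ := ((k + 1 : ℕ) : ℝ)
    have hr0 : 0 < r := by linarith
    -- The monotonicity is `2 log t ≤ t - 1 / t` at `t = (r + 1) / r`.
    have hq : 0 < (r + 1) / r := by positivity
    have hl := abs_log_le_abs_sub_inv (t := (r + 1) / r) hq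
    have h1 : 1 ≤ (r + 1) / r := by rw [le_div_iff₀ hr0]; linarith
    rw [abs_of_nonneg (Real.log_nonneg h1), abs_of_nonneg
      (sub_nonneg.mpr ((inv_le_one_of_one_le₀ h1).trans h1)),
      Real.log_div (by positivity) hr0.ne'] at hl
    have e : ((r + 1) / r - ((r + 1) / r)⁻¹) / 2 = r⁻¹ + 1 / (2 * (r + 1)) - 1 / (2 * r) := by
      field_simp
      ring
    linarith
  have ht : Filter.Tendsto u Filter.atTop (nhds 0) := by
    have h1 := (Filter.tendsto_add_atTop_iff_nat 1).mpr tendsto_integral_log_gammaMeasure_sub_log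
    have h2 : Filter.Tendsto (fun k : ℕ => 1 / (2 * ((k + 1 : ℕ) : ℝ))) Filter.atTop (nhds 0) := by
      have := (tendsto_one_div_add_atTop_nhds_zero_nat (𝕜 := ℝ)).const_mul (1 / 2)
      rw [mul_zero] at this
      refine this.congr fun k => ?_
      push_cast
      field_simp
    have h3 := h1.add h2
    rw [add_zero] at h3
    exact h3
  have h := hm.ge_of_tendsto ht (n - 1)
  simp only [hu, Nat.sub_add_cancel hn] at h
  linarith

/-- The sequence `ψ(n) - log n + 1 / (2n - 1)` decreases and tends to `0`. -/
theorem le_integral_log_gammaMeasure {n : ℕ} (hn : 1 ≤ n) :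
    -(1 / (2 * n - 1)) ≤ ∫ x, Real.log x ∂(gammaMeasure n 1) - Real.log n := by
  set u : ℕ → ℝ := fun k =>
    (∫ x, Real.log x ∂(gammaMeasure (k + 1 : ℕ) 1) - Real.log (k + 1 : ℕ))
      + 1 / (2 * ((k + 1 : ℕ) : ℝ) - 1) with hu
  have hm : Antitone u := by
    refine antitone_nat_of_succ_le fun k => ?_
    have hk : (1 : ℝ) ≤ (k + 1 : ℕ) := by exact_mod_cast Nat.le_add_left 1 k
    have hr := integral_log_gammaMeasure_add_one hk
    simp only [hu, Nat.cast_succ (k + 1), hr]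
    set r : ℝ := ((k + 1 : ℕ) : ℝ)
    have hr0 : 0 < r := by linarith
    have hl := Real.le_log_one_add_of_nonneg (x := r⁻¹) (by positivity)
    rw [show 1 + r⁻¹ = (r + 1) / r by field_simp, Real.log_div (by positivity) hr0.ne'] at hl
    have e : r⁻¹ + 1 / (2 * (r + 1) - 1) - 1 / (2 * r - 1) ≤ 2 * r⁻¹ / (r⁻¹ + 2) := by
      have h1 : 0 < 2 * r - 1 := by linarith
      have h2 : 0 < 2 * (r + 1) - 1 := by linarith
      have : 2 * r⁻¹ / (r⁻¹ + 2) - (r⁻¹ + 1 / (2 * (r + 1) - 1) - 1 / (2 * r - 1))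
          = 1 / (r * (2 * r - 1) * (2 * (r + 1) - 1)) := by
        have h3 : 1 + 2 * r ≠ 0 := by positivity
        have h2' := h2.ne'
        field_simp
        ring
      have h4 : 0 < 1 / (r * (2 * r - 1) * (2 * (r + 1) - 1)) := by positivity
      linarith
    linarith
  have ht : Filter.Tendsto u Filter.atTop (nhds 0) := by
    have h1 := (Filter.tendsto_add_atTop_iff_nat 1).mpr tendsto_integral_log_gammaMeasure_sub_log
    have h2 : Filter.Tendsto (fun k : ℕ => 1 / (2 * ((k + 1 : ℕ) : ℝ) - 1))
        Filter.atTop (nhds 0) := by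
      refine squeeze_zero (fun k => ?_) (fun k => ?_)
        (tendsto_one_div_add_atTop_nhds_zero_nat (𝕜 := ℝ))
      · push_cast
        exact one_div_nonneg.mpr (by linarith [k.cast_nonneg (α := ℝ)])
      · push_cast
        have := k.cast_nonneg (α := ℝ)
        exact one_div_le_one_div_of_le (by linarith) (by linarith)
    have h3 := h1.add h2
    rw [add_zero] at h3
    exact h3
  have h := hm.le_of_tendsto ht (n - 1)
  simp only [hu, Nat.sub_add_cancel hn] at h
  linarith

/-! ### A numerical bound for the Gaussian mass of an interval -/

theorem exp_neg_le_quadratic {u : ℝ} (hu : 0 ≤ u) : Real.exp (-u) ≤ 1 - u + u ^ 2 / 2 := by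
  have h := Real.quadratic_le_exp_of_nonneg hu
  have h1 := Real.exp_pos u
  rw [Real.exp_neg, inv_le_comm₀ h1 (by nlinarith [sq_nonneg (u - 1)])]
  refine le_trans ?_ h
  rw [inv_le_iff_one_le_mul₀ (by nlinarith [sq_nonneg (u - 1)])]
  nlinarith [sq_nonneg (u ^ 2)]

/-- A Gaussian with variance close to `1` gives mass at most `0.41` to
`(m - 0.194, m + 0.917]`. The density is bounded by a polynomial, through
`exp (-u) ≤ 1 - u + u² / 2` and `1 / √(2π) ≤ 0.4`; the resulting integral is about `0.40001`. -/
theorem gaussianReal_Ioc_le {m V y₁ y₂ : ℝ} (h1 : 1 ≤ V) (h2 : V ≤ 1.02) (hy₁ : m - 0.194 ≤ y₁)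
    (hy₂ : y₂ ≤ m + 0.917) :
    (gaussianReal m V.toNNReal).real (Set.Ioc y₁ y₂) ≤ 0.41 := by
  have hV0 : 0 < V := by linarith
  have hVn : V.toNNReal ≠ 0 := by simpa using hV0
  have hpoly : Continuous fun x : ℝ => 0.4 * (1 - x ^ 2 / 2.04 + x ^ 4 / 8) := by fun_prop
  have hpdf : ∀ x, gaussianPDFReal m V.toNNReal x
      ≤ 0.4 * (1 - (x - m) ^ 2 / 2.04 + (x - m) ^ 4 / 8) := by
    intro x
    rw [gaussianPDFReal, Real.coe_toNNReal _ hV0.le]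
    have hs : (√(2 * Real.pi * V))⁻¹ ≤ 0.4 := by
      have : (2.5 : ℝ) ≤ √(2 * Real.pi * V) := by
        apply Real.le_sqrt_of_sq_le
        nlinarith [Real.pi_gt_d2]
      calc (√(2 * Real.pi * V))⁻¹ ≤ (2.5 : ℝ)⁻¹ := by gcongr
        _ = 0.4 := by norm_num
    set w := (x - m) ^ 2 with hw
    have hw0 : 0 ≤ w := sq_nonneg _
    have he := exp_neg_le_quadratic (u := w / (2 * V)) (by positivity)
    have hu1 : w / 2.04 ≤ w / (2 * V) := by gcongr; linarith
    have hu2 : w / (2 * V) ≤ w / 2 := by gcongr; linarith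
    have hu0 : 0 ≤ w / (2 * V) := by positivity
    have hw4 : (x - m) ^ 4 = w ^ 2 := by rw [hw]; ring
    rw [neg_div, hw4]
    gcongr
    nlinarith
  calc (gaussianReal m V.toNNReal).real (Set.Ioc y₁ y₂)
      ≤ (gaussianReal m V.toNNReal).real (Set.Ioc (m - 0.194) (m + 0.917)) :=
        measureReal_mono (Set.Ioc_subset_Ioc hy₁ hy₂)
    _ = ∫ x in Set.Ioc (m - 0.194) (m + 0.917), gaussianPDFReal m V.toNNReal x := by
        rw [measureReal_def, gaussianReal_apply_eq_integral _ hVn,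
          ENNReal.toReal_ofReal (integral_nonneg fun t => gaussianPDFReal_nonneg _ _ t)]
    _ ≤ ∫ x in Set.Ioc (m - 0.194) (m + 0.917),
          0.4 * (1 - (x - m) ^ 2 / 2.04 + (x - m) ^ 4 / 8) :=
        setIntegral_mono (integrable_gaussianPDFReal _ _).integrableOn
          ((hpoly.comp (continuous_sub_right m)).integrableOn_Ioc) hpdf
    _ = ∫ x in (-0.194 : ℝ)..0.917, 0.4 * (1 - x ^ 2 / 2.04 + x ^ 4 / 8) := by
        rw [← intervalIntegral.integral_of_le (by linarith),
          intervalIntegral.integral_comp_sub_right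
            (fun x : ℝ => 0.4 * (1 - x ^ 2 / 2.04 + x ^ 4 / 8)) m]
        congr 1 <;> ring
    _ ≤ 0.41 := by
        have hd : ∀ x ∈ Set.uIcc (-0.194 : ℝ) 0.917, HasDerivAt
            (fun x : ℝ => 0.4 * (x - x ^ 3 / 6.12 + x ^ 5 / 40))
            (0.4 * (1 - x ^ 2 / 2.04 + x ^ 4 / 8)) x := by
          intro x _
          convert! ((((hasDerivAt_id x).sub ((hasDerivAt_pow 3 x).div_const 6.12)).add
            ((hasDerivAt_pow 5 x).div_const 40)).const_mul 0.4) using 1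
          norm_num
          ring
        rw [intervalIntegral.integral_eq_sub_of_hasDerivAt hd (hpoly.intervalIntegrable _ _)]
        norm_num

theorem log_three_halves_le : Real.log (3 / 2) ≤ 0.406 := by
  rw [Real.log_le_iff_le_exp (by norm_num)]
  have h := Real.sum_le_exp_of_nonneg (x := 0.406) (by norm_num) 5
  refine le_trans ?_ h
  norm_num [Finset.sum_range_succ, Nat.factorial]

/-! ### Products of squared row norms -/

theorem measurable_ell {n : ℕ} : Measurable (ell n) := Real.measurable_log.comp measurable_sqNorm

theorem measurable_rowSq {n : ℕ} (i : Fin n) : Measurable (rowSq i) :=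
  measurable_sqNorm.comp (measurable_pi_apply i)

theorem measurable_R {n : ℕ} : Measurable (R (n := n)) := by
  unfold R
  exact Finset.measurable_prod _ fun i _ => measurable_rowSq i

theorem measurePreserving_sqNorm {n : ℕ} (hn : 1 ≤ n) :
    MeasurePreserving sqNorm (gaussianVector n) (gammaMeasure n 1) :=
  ⟨measurable_sqNorm, map_sqNorm hn⟩

theorem measurePreserving_rowSq {n : ℕ} (hn : 1 ≤ n) :
    MeasurePreserving (fun (X : Fin n → Fin n → ℂ) i => rowSq i X) (gaussianMatrix n)
      (Measure.pi fun _ : Fin n => gammaMeasure n 1) := by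
  have := isProbabilityMeasure_gammaMeasure (a := n) (by exact_mod_cast hn) one_pos
  exact measurePreserving_pi _ _ fun _ => measurePreserving_sqNorm hn

theorem measurePreserving_row {n : ℕ} (i : Fin n) :
    MeasurePreserving (fun X : Fin n → Fin n → ℂ => X i) (gaussianMatrix n) (gaussianVector n) :=
  measurePreserving_eval (fun _ : Fin n => gaussianVector n) i

theorem ae_rowSq_pos {n : ℕ} (hn : 1 ≤ n) :
    ∀ᵐ X ∂(gaussianMatrix n), ∀ i : Fin n, 0 < rowSq i X := by
  rw [ae_all_iff]
  intro i
  exact ((measurePreserving_sqNorm hn).comp (measurePreserving_row i)).quasiMeasurePreserving.ae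
    (ae_pos_gammaMeasure n)

theorem ae_L_eq {n : ℕ} (hn : 1 ≤ n) :
    ∀ᵐ X ∂(gaussianMatrix n), L X = ∑ i, Real.log (rowSq i X) := by
  filter_upwards [ae_rowSq_pos hn] with X hX
  exact Real.log_prod fun i _ => (hX i).ne'

theorem integral_ell {n : ℕ} (hn : 1 ≤ n) :
    ∫ v, ell n v ∂(gaussianVector n) = ∫ x, Real.log x ∂(gammaMeasure n 1) := by
  rw [← map_sqNorm hn, integral_map measurable_sqNorm.aemeasurable (by fun_prop)]
  rfl

theorem variance_ell {n : ℕ} (hn : 1 ≤ n) :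
    variance (ell n) (gaussianVector n) = variance Real.log (gammaMeasure n 1) := by
  rw [← map_sqNorm hn, variance_map (by fun_prop) measurable_sqNorm.aemeasurable]
  rfl

theorem memLp_ell {n : ℕ} (hn : 1 ≤ n) : MemLp (ell n) 2 (gaussianVector n) :=
  (memLp_log_gammaMeasure (by exact_mod_cast hn)).comp_measurePreserving
    (measurePreserving_sqNorm hn)

theorem integrable_Rstar {n : ℕ} (hn : 1 ≤ n) :
    Integrable (Rstar (n := n)) (gaussianMatrix n) := by
  have h : Integrable (sqNorm (n := n)) (gaussianVector n) :=
    ((memLp_id_gammaMeasure (by exact_mod_cast hn)).comp_measurePreserving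
      (measurePreserving_sqNorm hn)).integrable one_le_two
  exact (Integrable.fintype_prod (ι := Fin n) (f := fun _ => sqNorm) fun _ => h).div_const _

theorem mul_variance_log_gammaMeasure_sub_one_le {n : ℕ} (hn : 2 ≤ n) :
    n * variance Real.log (gammaMeasure n 1) - 1 ≤ ((n : ℝ) - 1)⁻¹ := by
  have hn' : (2 : ℝ) ≤ n := by exact_mod_cast hn
  have h := variance_log_gammaMeasure_le (a := n) (by linarith)
  have h1 : (n : ℝ) - 1 ≠ 0 := by linarith
  calc n * variance Real.log (gammaMeasure n 1) - 1 ≤ n * ((n : ℝ) - 1)⁻¹ - 1 := by gcongr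
    _ = _ := by field_simp; ring

/-- The rate comes from `n Var[ℓₙ] - 1 ≤ 1 / (n - 1) ≤ 2 / n`. For `n = 1` the bound is trivial. -/
theorem abs_cdf_L_sub_le {n : ℕ} (hn : 1 ≤ n) (x : ℝ) :
    |(gaussianMatrix n).real {X | L X ≤ x} -
        (gaussianReal (n * ∫ v, ell n v ∂(gaussianVector n))
          (Real.toNNReal (n * variance (ell n) (gaussianVector n)))).real
            (Set.Iic x)| ≤ 4 / √n := by
  rcases hn.eq_or_lt with rfl | hn2
  · have h1 : (gaussianMatrix 1).real {X | L X ≤ x} ≤ 1 := measureReal_le_one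
    have h2 : 0 ≤ (gaussianMatrix 1).real {X | L X ≤ x} := measureReal_nonneg
    set ρ := gaussianReal ((1 : ℕ) * ∫ v, ell 1 v ∂(gaussianVector 1))
          (Real.toNNReal ((1 : ℕ) * variance (ell 1) (gaussianVector 1)))
    have h3 : ρ.real (Set.Iic x) ≤ 1 := measureReal_le_one
    have h4 : 0 ≤ ρ.real (Set.Iic x) := measureReal_nonneg
    rw [abs_le]
    constructor <;> norm_num <;> linarith
  · have hn1 : (1 : ℝ) ≤ n := by exact_mod_cast hn
    have hn2' : (2 : ℝ) ≤ n := by exact_mod_cast hn2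
    have hms : MeasurableSet {g : Fin n → ℝ | ∑ j, Real.log (g j) ≤ x} :=
      measurableSet_le (by fun_prop) measurable_const
    have e : (gaussianMatrix n).real {X | L X ≤ x}
        = (Measure.pi fun _ : Fin n => gammaMeasure n 1).real
          {g | ∑ j, Real.log (g j) ≤ x} := by
      rw [← (measurePreserving_rowSq hn).measureReal_preimage hms.nullMeasurableSet]
      refine measureReal_congr ?_
      filter_upwards [ae_L_eq hn] with X hX
      exact congrArg (· ≤ x) hX
    rw [e, integral_ell hn, variance_ell hn]
    refine (abs_cdf_sum_log_gamma_sub_le hn1 hn x).trans ?_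
    rw [← Real.sqrt_mul (by positivity)]
    rw [show (4 : ℝ) = √16 by rw [show (16 : ℝ) = 4 ^ 2 by norm_num]; simp,
      ← Real.sqrt_div (by norm_num)]
    apply Real.sqrt_le_sqrt
    have h := mul_variance_log_gammaMeasure_sub_one_le hn2
    have h2 : ((n : ℝ) - 1)⁻¹ ≤ 2 / n := by
      rw [inv_eq_one_div, div_le_div_iff₀ (by linarith) (by linarith)]
      linarith
    calc 2 * Real.pi * (n * variance Real.log (gammaMeasure n 1) - 1)
        ≤ 2 * 4 * (2 / n) := by
          have := Real.pi_le_four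
          have := Real.pi_pos
          have h0 := one_le_mul_variance_log_gammaMeasure hn1
          gcongr
          exact h.trans h2
      _ = 16 / n := by ring

/-- The event `|R* - 1| < 1/2` confines `L - n log n` to `(-log 2, log (3/2))`. The approximating
Gaussian has, after the shift by `n log n`, mean in `[-0.511, -1/2]` and variance in `[1, 1.02]` as
soon as `n ≥ 51`, hence gives this interval mass at most `0.41`. For smaller `n` the left-hand side
is negative. -/
theorem le_measure_fluctuation {n : ℕ} (hn : 1 ≤ n) :
    0.586 - 8 / √n ≤ (gaussianMatrix n).real {X | 1 / 2 ≤ |Rstar X - 1|} := by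
  have hn0 : (0 : ℝ) < n := by exact_mod_cast hn
  rcases le_or_gt 51 n with h51 | h51
  · have hn51 : (51 : ℝ) ≤ n := by exact_mod_cast h51
    set t₁ := n * Real.log n - Real.log 2 with ht₁
    set t₂ := n * Real.log n + Real.log (3 / 2) with ht₂
    have hl2 := Real.log_two_lt_d9
    have hl3 := log_three_halves_le
    have h12 : t₁ ≤ t₂ := by
      have h1 := Real.log_nonneg (show (1 : ℝ) ≤ 2 by norm_num)
      have h2 := Real.log_nonneg (show (1 : ℝ) ≤ 3 / 2 by norm_num)
      linarith
    set S := {X : Fin n → Fin n → ℂ | 1 / 2 ≤ |Rstar X - 1|} with hS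
    have hRm : Measurable (Rstar (n := n)) := measurable_R.div_const _
    have hLm : Measurable (L (n := n)) := Real.measurable_log.comp measurable_R
    have hSm : MeasurableSet S := measurableSet_le measurable_const (by fun_prop)
    have hms : ∀ t, MeasurableSet {X : Fin n → Fin n → ℂ | L X ≤ t} := fun t =>
      measurableSet_le hLm measurable_const
    have hnn : (0 : ℝ) < (n : ℝ) ^ n := by positivity
    have hsub : (Sᶜ : Set _) ≤ᵐ[gaussianMatrix n] {X | L X ≤ t₂} \ {X | L X ≤ t₁} := by
      filter_upwards [ae_rowSq_pos hn] with X hX hXS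
      have hR : 0 < R X := Finset.prod_pos fun i _ => hX i
      have hlR : Real.log (Rstar X) = L X - n * Real.log n := by
        rw [Rstar, Real.log_div hR.ne' hnn.ne', Real.log_pow]; rfl
      have hR' : 0 < Rstar X := div_pos hR hnn
      have hXS : ¬ (1 / 2 ≤ |Rstar X - 1|) := hXS
      rw [not_le, abs_lt] at hXS
      have a1 : Real.log (Rstar X) ≤ Real.log (3 / 2) := Real.log_le_log hR' (by linarith)
      have a2 : Real.log (1 / 2) < Real.log (Rstar X) :=
        Real.log_lt_log (by norm_num) (by linarith)
      rw [one_div, Real.log_inv] at a2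
      refine ⟨?_, ?_⟩
      · change L X ≤ t₂
        linarith
      · change ¬ (L X ≤ t₁)
        linarith
    have h1 : (gaussianMatrix n).real Sᶜ ≤
        (gaussianMatrix n).real {X | L X ≤ t₂} - (gaussianMatrix n).real {X | L X ≤ t₁} := by
      have hAB : {X : Fin n → Fin n → ℂ | L X ≤ t₁} ⊆ {X | L X ≤ t₂} := fun X hX =>
        le_trans hX h12
      rw [← measureReal_sdiff hAB (hms t₁)]
      exact ENNReal.toReal_mono (measure_ne_top _ _) (measure_mono_ae hsub)
    rw [probReal_compl_eq_one_sub hSm] at h1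
    have b1 := abs_le.mp (abs_cdf_L_sub_le hn t₁)
    have b2 := abs_le.mp (abs_cdf_L_sub_le hn t₂)
    set ρ := gaussianReal (n * ∫ v, ell n v ∂(gaussianVector n))
          (Real.toNNReal (n * variance (ell n) (gaussianVector n))) with hρ
    have h2 : ρ.real (Set.Iic t₂) - ρ.real (Set.Iic t₁) = ρ.real (Set.Ioc t₁ t₂) := by
      rw [← Set.Iic_sdiff_Iic, measureReal_sdiff (Set.Iic_subset_Iic.mpr h12) measurableSet_Iic]
    have hm1 := integral_log_gammaMeasure_le hn
    have hm2 := le_integral_log_gammaMeasure hn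
    have h3 : ρ.real (Set.Ioc t₁ t₂) ≤ 0.41 := by
      rw [hρ, integral_ell hn, variance_ell hn]
      set μ := ∫ x, Real.log x ∂(gammaMeasure n 1)
      have c1 : n * (μ - Real.log n) ≤ -(1 / 2) := by
        calc n * (μ - Real.log n) ≤ n * (-(1 / (2 * n))) := by gcongr
          _ = _ := by field_simp
      have c2 : -0.511 ≤ n * (μ - Real.log n) := by
        refine le_trans ?_ (mul_le_mul_of_nonneg_left hm2 hn0.le)
        have : n * (1 / (2 * (n : ℝ) - 1)) ≤ 0.511 := by
          rw [mul_one_div, div_le_iff₀ (by linarith)]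
          linarith
        linarith
      refine gaussianReal_Ioc_le (one_le_mul_variance_log_gammaMeasure (by linarith)) ?_ ?_ ?_
      · have h := mul_variance_log_gammaMeasure_sub_one_le (n := n) (by omega)
        have : ((n : ℝ) - 1)⁻¹ ≤ (50 : ℝ)⁻¹ := by gcongr; linarith
        norm_num at this ⊢
        linarith
      · rw [ht₁]; linarith
      · rw [ht₂]; linarith
    have h4 : 8 / √(n : ℝ) = 4 / √n + 4 / √n := by ring
    rw [h4]
    linarith
  · refine le_trans ?_ measureReal_nonneg
    have hn51 : (n : ℝ) ≤ 8 ^ 2 := by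
      have : (n : ℝ) < 51 := by exact_mod_cast h51
      linarith
    have hs : √(n : ℝ) ≤ 8 := Real.sqrt_le_iff.mpr ⟨by norm_num, hn51⟩
    have : 1 ≤ 8 / √(n : ℝ) := by rwa [le_div_iff₀ (by positivity), one_mul]
    linarith

/-- Markov's inequality, with `0.586 / 4 = 0.1465`. -/
theorem le_integral_fluctuation {n : ℕ} (hn : 1 ≤ n) :
    0.146 - 2 / √n ≤ 1 / 2 * ∫ X, |Rstar X - 1| ∂(gaussianMatrix n) := by
  have hi : Integrable (fun X => |Rstar X - 1|) (gaussianMatrix n) :=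
    ((integrable_Rstar hn).sub (integrable_const 1)).abs
  have h := mul_meas_ge_le_integral_of_nonneg
    (Filter.Eventually.of_forall fun X => abs_nonneg _) hi (1 / 2)
  have h2 := le_measure_fluctuation hn
  have h4 : 8 / √(n : ℝ) = 4 * (2 / √n) := by ring
  linarith

end RowNorm

theorem mainTheorem10 :
    -- `L` is almost surely the sum of the `ln Rᵢ`, which are independent and distributed as `ℓₙ`;
    -- `ℓₙ` has a mean and a variance, and `R*` has an expectation
    (∀ n : ℕ, 1 ≤ n →
      (∀ᵐ X ∂(RowNorm.gaussianMatrix n), RowNorm.L X = ∑ i, Real.log (RowNorm.rowSq i X)) ∧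
      iIndepFun (fun (i : Fin n) (X : Fin n → Fin n → ℂ) => Real.log (RowNorm.rowSq i X))
        (RowNorm.gaussianMatrix n) ∧
      (∀ i : Fin n, IdentDistrib (fun X => Real.log (RowNorm.rowSq i X)) (RowNorm.ell n)
        (RowNorm.gaussianMatrix n) (RowNorm.gaussianVector n)) ∧
      MemLp (RowNorm.ell n) 2 (RowNorm.gaussianVector n) ∧
      Integrable (RowNorm.Rstar (n := n)) (RowNorm.gaussianMatrix n)) ∧
    -- the distribution function of `L` is `O(1/√n)`-close to that of the Gaussian with mean
    -- `n E[ℓₙ]` and variance `n Var[ℓₙ]`, uniformly in `x`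
    (∃ C : ℝ, ∀ n : ℕ, 1 ≤ n → ∀ x : ℝ,
      |(RowNorm.gaussianMatrix n).real {X | RowNorm.L X ≤ x} -
        (gaussianReal (n * ∫ v, RowNorm.ell n v ∂(RowNorm.gaussianVector n))
          (Real.toNNReal (n * variance (RowNorm.ell n) (RowNorm.gaussianVector n)))).real
            (Set.Iic x)| ≤ C / Real.sqrt n) ∧
    -- the two lower bounds on the fluctuations of `R*`
    (∃ C : ℝ, ∀ n : ℕ, 1 ≤ n →
      0.586 - C / Real.sqrt n ≤
        (RowNorm.gaussianMatrix n).real {X | 1 / 2 ≤ |RowNorm.Rstar X - 1|}) ∧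
    (∃ C : ℝ, ∀ n : ℕ, 1 ≤ n →
      0.146 - C / Real.sqrt n ≤
        1 / 2 * ∫ X, |RowNorm.Rstar X - 1| ∂(RowNorm.gaussianMatrix n)) := by
  open RowNorm in
  refine ⟨fun n hn => ⟨ae_L_eq hn, ?_, fun i => ?_, memLp_ell hn, integrable_Rstar hn⟩,
    ⟨4, fun n hn x => abs_cdf_L_sub_le hn x⟩, ⟨8, fun n hn => le_measure_fluctuation hn⟩,
    ⟨2, fun n hn => le_integral_fluctuation hn⟩⟩
  · exact iIndepFun_pi (X := fun _ : Fin n => ell n) fun _ => measurable_ell.aemeasurable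
  · refine ⟨(measurable_ell.comp (measurable_pi_apply i)).aemeasurable,
      measurable_ell.aemeasurable, ?_⟩
    rw [← (measurePreserving_row i).map_eq, Measure.map_map measurable_ell (measurable_pi_apply i)]
    rfl
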